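/- Let $d\ge 0$ be an integer, and let $\mathrm{SL}_2(\mathbb C)$ act on binary forms of degree $d$ by $(g\cdot f)(v)=f(g^{-1}v)$ and on $\mathbb C^2$ in the standard way. Let $C_d$ be the algebra of covariants of binary $d$-forms, i.e. the algebra of those polynomials $F(f,v)$ in the $d+1$ coefficients of a binary $d$-form $f$ and the two coordinates of a vector $v\in\mathbb C^2$ that satisfy $F(g\cdot f,gv)=F(f,v)$ for all $g\in\mathrm{SL}_2(\mathbb C)$, and let $(C_d)_n\subset C_d$ be the subspace of covariants that are homogeneous of degree $n$ in the coefficients of $f$. Then every $(C_d)_n$ is finite-dimensional, and the Poincaré series $P_d(z)=\sum_{n\ge 0}\dim (C_d)_n\,z^n$ satisfies $$P_d(z)=\Psi_{1,d}\left(\frac{1+z}{(1-t)(1-tz^2)\cdots(1-tz^{2d})}\right)$$ in $\mathbb C[[z]]$, where the fraction is expanded in $\mathbb C[[t,z]]$ and $\Psi_{1,d}:\mathbb C[[t,z]]\to\mathbb C[[z]]$ is the linear map $\sum_{i,j\ge 0}a_{i,j}t^iz^j\mapsto\sum_{s\ge 0}a_{s,ds}z^s$. Moreover, for every complex $t$ with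 $|t|<1$ the series $P_d(t)$ converges and $$P_d(t)=\frac1{2\pi i}\oint_{|z|=1}\frac{1+z}{\prod_{k=0}^d(1-tz^{d-2k})}\,\frac{dz}{z}.$$ -/

import Mathlib

namespace BinaryForms

noncomputable section

/-- The natural action of `SL₂(ℂ)` on polynomials in two variables:
`(g • f)(v) = f (g⁻¹ v)`, i.e. `x i` is replaced by `∑ j, (g⁻¹) i j * x j`. It preserves the space
of binary forms of each degree, see `act_isHomogeneous`. -/
def act (g : Matrix.SpecialLinearGroup (Fin 2) ℂ) (f : MvPolynomial (Fin 2) ℂ) :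
    MvPolynomial (Fin 2) ℂ :=
  MvPolynomial.bind₁
    (fun i => ∑ j, MvPolynomial.C ((g⁻¹).val i j) * MvPolynomial.X j) f

theorem act_isHomogeneous (d : ℕ) (g : Matrix.SpecialLinearGroup (Fin 2) ℂ)
    (f : MvPolynomial (Fin 2) ℂ) (hf : f.IsHomogeneous d) : (act g f).IsHomogeneous d := by
  have h := MvPolynomial.IsHomogeneous.aeval hf
    (g := fun i => ∑ j, MvPolynomial.C ((g⁻¹).val i j) * MvPolynomial.X j) (n := 1)
    (fun i => MvPolynomial.IsHomogeneous.sum _ _ _ fun j _ =>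
      MvPolynomial.isHomogeneous_C_mul_X _ _)
  rw [one_mul] at h
  exact h

/-- The coordinates of a binary `d`-form: the coefficient of `x₀ ^ (d - i) * x₁ ^ i`. -/
def formCoeff (d : ℕ) (f : MvPolynomial (Fin 2) ℂ) (i : Fin (d + 1)) : ℂ :=
  f.coeff (Finsupp.single 0 (d - (i : ℕ)) + Finsupp.single 1 (i : ℕ))

/-- The polynomial functions on `(binary d-forms) × ℂ²`: polynomials in the `d + 1` coefficients
of the form (`Sum.inl i`) and in the two coordinates of the vector (`Sum.inr j`). -/
abbrev FormPoly (d : ℕ) : Type := MvPolynomial (Fin (d + 1) ⊕ Fin 2) ℂ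

/-- The value of `F` at the binary `d`-form `f` and the vector `v`. -/
def evalAt (d : ℕ) (F : FormPoly d) (f : MvPolynomial (Fin 2) ℂ) (v : Fin 2 → ℂ) : ℂ :=
  MvPolynomial.eval (Sum.elim (formCoeff d f) v) F

/-- The algebra `C_d` of covariants of binary `d`-forms: the polynomial functions `F(f, v)` of a
binary `d`-form `f` and a vector `v ∈ ℂ²` that are invariant under the simultaneous action of
`SL₂(ℂ)`. -/
def covariants (d : ℕ) : Subalgebra ℂ (FormPoly d) where
  carrier := {F | ∀ (g : Matrix.SpecialLinearGroup (Fin 2) ℂ) (f : MvPolynomial (Fin 2) ℂ),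
    f.IsHomogeneous d → ∀ v : Fin 2 → ℂ,
      evalAt d F (act g f) (g.val.mulVec v) = evalAt d F f v}
  mul_mem' := by
    intro F G hF hG g f hf v
    have h1 := hF g f hf v
    have h2 := hG g f hf v
    simp only [evalAt, map_mul] at h1 h2 ⊢
    rw [h1, h2]
  add_mem' := by
    intro F G hF hG g f hf v
    have h1 := hF g f hf v
    have h2 := hG g f hf v
    simp only [evalAt, map_add] at h1 h2 ⊢
    rw [h1, h2]
  algebraMap_mem' := by
    intro c g f _ v
    simp [evalAt, MvPolynomial.algebraMap_eq]

/-- The homogeneous component `(C_d)_n`: the covariants that are homogeneous of degree `n` in the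
coefficients of the form (of any order, i.e. any degree in the vector variables). -/
def covariantsOfDegree (d n : ℕ) : Submodule ℂ (FormPoly d) :=
  Subalgebra.toSubmodule (covariants d) ⊓
    MvPolynomial.weightedHomogeneousSubmodule ℂ
      (Sum.elim (fun _ => 1) (fun _ => 0) : Fin (d + 1) ⊕ Fin 2 → ℕ) n

/-- The Poincaré series `P_d(z) = ∑ dim (C_d)_n zⁿ ∈ ℤ[[z]]`. -/
def poincareSeries (d : ℕ) : PowerSeries ℤ :=
  PowerSeries.mk fun n => (Module.finrank ℂ (covariantsOfDegree d n) : ℤ)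

/-- The linear map `Ψ_{m,n} : ℂ[[t, z]] → ℂ[[z]]`, `∑ a_{i,j} tⁱ zʲ ↦ ∑ a_{ms,ns} zˢ`.
In `ℂ[[t, z]]` the variable `t` has index `0` and `z` has index `1`. -/
def Psi (m n : ℕ) : MvPowerSeries (Fin 2) ℂ →ₗ[ℂ] PowerSeries ℂ where
  toFun A := PowerSeries.mk fun s =>
    MvPowerSeries.coeff (Finsupp.single 0 (m * s) + Finsupp.single 1 (n * s)) A
  map_add' A B := by
    ext s
    simp
  map_smul' c A := by
    ext s
    simp

/-- The power series `(1 + z) / ((1 - t)(1 - t z²) ⋯ (1 - t z^{2d})) ∈ ℂ[[t, z]]`; the denominator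
has constant term `1`. -/
def covariantGenFun (d : ℕ) : MvPowerSeries (Fin 2) ℂ :=
  (1 + MvPowerSeries.X 1) *
    (∏ k ∈ Finset.range (d + 1),
      (1 - MvPowerSeries.X 0 * MvPowerSeries.X 1 ^ (2 * k)))⁻¹

/-- The function `z ↦ (1 + z) / ∏_{k = 0}^{d} (1 - t z^{d - 2k}) · (1 / z)`. -/
def contourIntegrand (d : ℕ) (t z : ℂ) : ℂ :=
  (1 + z) / (∏ k ∈ Finset.range (d + 1), (1 - t * z ^ ((d : ℤ) - 2 * (k : ℤ)))) * (1 / z)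

end

end BinaryForms

/-! A covariant is determined by its source, its restriction to `v = (1, 0)`: `SL₂(ℂ)` is transitive
on nonzero vectors, so `F(a, g e₁) = P(g⁻¹ a)` where `P` is the source. The stabilizer of `e₁` is
the unipotent group `U`, so `P` is `U`-invariant. Conversely, for a `U`-invariant `P` of degree `n`
this formula is well defined for `v ≠ 0`. Computing it with one choice of `g` gives a polynomial
over `v₀^(dn)`, with another a polynomial over `v₁^(dn)`; coprimality makes the function a
polynomial (`exists_eq_X_pow_mul`, `exists_covariant_of_raising_eq_zero`).

Being `U`-invariant means being killed by the raising operator `E` (`raising_eq_zero_iff`), which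
belongs to an `sl₂`-triple on the forms of degree `n`. There `E` is injective on negative weights
and onto each positive weight space. If `m_e` monomials have weight `e`, the kernel thus has
dimension `∑_{e ≥ 0} (m_e - m_{e+2}) = m₀ + m₁` (`finrank_ker_raising`).

Both formulas count the same monomials. One of degree `n` and weight `e` contributes `t^n z^(dn -
e)` to the product of geometric series, so the factor `1 + z` picks out `e = 0` and `e = 1` at `t^n
z^(dn)`. In the contour integral, the same series is integrated term by term on the unit circle, and
only the exponent `-1` survives. -/

namespace BinaryForms

open Module

/-! ### Weight decomposition with respect to a diagonal operator -/

section WeightProjection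

variable {V ι : Type*} [AddCommGroup V] [Module ℂ V]

/-- The projection onto the span of the basis vectors of weight `μ`. -/
noncomputable def weightProj (b : Basis ι ℂ V) (w : ι → ℤ) (μ : ℤ) : V →ₗ[ℂ] V :=
  b.constr ℂ fun i => if w i = μ then b i else 0

theorem weightProj_basis (b : Basis ι ℂ V) (w : ι → ℤ) (μ : ℤ) (i : ι) :
    weightProj b w μ (b i) = if w i = μ then b i else 0 := by
  rw [weightProj, Basis.constr_basis]

theorem repr_weightProj (b : Basis ι ℂ V) (w : ι → ℤ) (μ : ℤ) (v : V) (i : ι) :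
    b.repr (weightProj b w μ v) i = if w i = μ then b.repr v i else 0 := by
  classical
  have h : (Finsupp.lapply i ∘ₗ b.repr.toLinearMap) ∘ₗ weightProj b w μ =
      if w i = μ then Finsupp.lapply i ∘ₗ b.repr.toLinearMap else 0 := by
    refine b.ext fun j => ?_
    by_cases hj : w j = μ <;> by_cases hi : w i = μ <;>
      simp [weightProj_basis, hj, hi, Finsupp.single_apply]
    · rintro rfl; exact hi hj
    · rintro rfl; exact hj hi
  have := LinearMap.congr_fun h v
  split_ifs at this ⊢ <;> simpa using this

theorem repr_diagonal {b : Basis ι ℂ V} {w : ι → ℤ} {H : V →ₗ[ℂ] V}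
    (hH : ∀ i, H (b i) = (w i : ℂ) • b i) (v : V) (i : ι) :
    b.repr (H v) i = (w i : ℂ) * b.repr v i := by
  classical
  have h : (Finsupp.lapply i ∘ₗ b.repr.toLinearMap) ∘ₗ H =
      (w i : ℂ) • (Finsupp.lapply i ∘ₗ b.repr.toLinearMap) := by
    refine b.ext fun j => ?_
    by_cases hj : j = i
    · subst hj; simp [hH]
    · simp [hH, hj]
  simpa using LinearMap.congr_fun h v

theorem diagonal_weightProj {b : Basis ι ℂ V} {w : ι → ℤ} {H : V →ₗ[ℂ] V}
    (hH : ∀ i, H (b i) = (w i : ℂ) • b i) (μ : ℤ) (v : V) :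
    H (weightProj b w μ v) = (μ : ℂ) • weightProj b w μ v := by
  refine b.repr.injective (Finsupp.ext fun i => ?_)
  rw [repr_diagonal hH, map_smul, Finsupp.smul_apply, repr_weightProj]
  split_ifs with h <;> simp [h]

/-- Comparing coordinates in `HE - EH = 2E` shows that `E (b i)` involves only basis vectors of
weight `w i + 2`. -/
theorem raising_weightProj {b : Basis ι ℂ V} {w : ι → ℤ} {H E : V →ₗ[ℂ] V}
    (hH : ∀ i, H (b i) = (w i : ℂ) • b i) (hE : ∀ v, H (E v) - E (H v) = (2 : ℂ) • E v)
    (μ : ℤ) (v : V) :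
    E (weightProj b w μ v) = weightProj b w (μ + 2) (E v) := by
  suffices h : E ∘ₗ weightProj b w μ = weightProj b w (μ + 2) ∘ₗ E from LinearMap.congr_fun h v
  refine b.ext fun i => b.repr.injective (Finsupp.ext fun j => ?_)
  have key : ((w j : ℂ) - w i - 2) * b.repr (E (b i)) j = 0 := by
    have := congrArg (fun x => b.repr x j) (hE (b i))
    simp only [hH, map_smul, map_sub, Finsupp.sub_apply, Finsupp.smul_apply,
      repr_diagonal hH, smul_eq_mul] at this
    linear_combination this
  simp only [LinearMap.comp_apply, weightProj_basis, repr_weightProj]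
  rcases mul_eq_zero.mp key with h | h
  · have h' : w j = w i + 2 := by
      have : (w j : ℂ) = ((w i + 2 : ℤ) : ℂ) := by push_cast; linear_combination h
      exact_mod_cast this
    by_cases hi : w i = μ
    · simp [hi, h']
    · have : w j ≠ μ + 2 := by omega
      simp [hi, this]
  · split_ifs <;> simp [h]

end WeightProjection

/-! ### The kernel of the raising operator in a finite-dimensional `sl₂`-representation -/

section Sl2

attribute [local instance] LieRing.ofAssociativeRing

variable {V ι : Type*} [AddCommGroup V] [Module ℂ V] [Fintype ι]

theorem eq_natCast_of_raising_eq_zero [FiniteDimensional ℂ V] {E F H : V →ₗ[ℂ] V}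
    (hEF : ∀ v, E (F v) - F (E v) = H v) (hHE : ∀ v, H (E v) - E (H v) = (2 : ℂ) • E v)
    (hHF : ∀ v, H (F v) - F (H v) = -((2 : ℂ) • F v)) {v : V} {μ : ℂ} (hv : v ≠ 0)
    (hE : E v = 0) (hμ : H v = μ • v) : ∃ n : ℕ, μ = n := by
  -- `IsSl2Triple` demands a nonzero `H`; if `H = 0` the weight is `0`.
  by_cases h0 : H = 0
  · refine ⟨0, ?_⟩
    rw [h0, LinearMap.zero_apply, eq_comm, smul_eq_zero] at hμ
    simpa using hμ.resolve_right hv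
  have t : IsSl2Triple (L := Module.End ℂ V) H E F := by
    refine ⟨h0, ?_, ?_, ?_⟩
    · ext v; simpa [Ring.lie_def] using hEF v
    · ext v; simpa [Ring.lie_def, two_smul] using hHE v
    · ext v; simpa [Ring.lie_def, two_smul] using hHF v
  have P : t.HasPrimitiveVectorWith v μ := ⟨hv, by simpa using hμ, by simpa using hE⟩
  exact P.exists_nat

/-- Each weight component of a vector killed by `E` is again killed by `E`, so if nonzero it is
primitive and its weight is a natural number. -/
theorem repr_eq_zero_of_raising_eq_zero {b : Basis ι ℂ V} {w : ι → ℤ} {E F H : V →ₗ[ℂ] V}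
    (hH : ∀ i, H (b i) = (w i : ℂ) • b i)
    (hEF : ∀ v, E (F v) - F (E v) = H v) (hHE : ∀ v, H (E v) - E (H v) = (2 : ℂ) • E v)
    (hHF : ∀ v, H (F v) - F (H v) = -((2 : ℂ) • F v)) {v : V} (hv : E v = 0) {i : ι}
    (hi : w i < 0) : b.repr v i = 0 := by
  have : FiniteDimensional ℂ V := b.finiteDimensional_of_finite
  have h0 : weightProj b w (w i) v = 0 := by
    by_contra hne
    obtain ⟨n, hn⟩ := eq_natCast_of_raising_eq_zero hEF hHE hHF hne
      (by rw [raising_weightProj hH hHE, hv, map_zero]) (diagonal_weightProj hH (w i) v)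
    have : w i = n := by exact_mod_cast hn
    omega
  have := repr_weightProj b w (w i) v i
  simpa [h0] using this.symm

/-- Dual to the previous lemma. If `b i` were outside the range of `E`, some functional `φ` would
kill the range but not `b i`. The transposes of `E`, `F` and `-H` satisfy the same relations, with
weights `-w`, and `φ` lies in the kernel of the transposed `E`, so its coordinate `φ (b i)` at the
negative weight `-w i` vanishes. -/
theorem mem_range_raising {b : Basis ι ℂ V} {w : ι → ℤ} {E F H : V →ₗ[ℂ] V}
    (hH : ∀ i, H (b i) = (w i : ℂ) • b i)
    (hEF : ∀ v, E (F v) - F (E v) = H v) (hHE : ∀ v, H (E v) - E (H v) = (2 : ℂ) • E v)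
    (hHF : ∀ v, H (F v) - F (H v) = -((2 : ℂ) • F v)) {i : ι} (hi : 0 < w i) :
    b i ∈ LinearMap.range E := by
  classical
  by_contra hne
  obtain ⟨φ, hφ, hφE⟩ := Submodule.exists_le_ker_of_notMem hne
  refine hφ ?_
  have := repr_eq_zero_of_raising_eq_zero (b := b.dualBasis) (w := fun i => - w i)
    (E := E.dualMap) (F := F.dualMap) (H := -H.dualMap) (v := φ) (i := i) ?_ ?_ ?_ ?_ ?_ (by simpa)
  · simpa using this
  · intro j
    refine b.ext fun k => ?_
    by_cases h : k = j
    · subst h; simp [hH]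
    · simp [hH, h]
  · intro ψ
    ext v
    have := congrArg ψ (hEF v)
    simp only [map_sub] at this
    simp [← this]
  · intro ψ
    ext v
    have := congrArg ψ (hHE v)
    simp only [map_sub, map_smul] at this
    simp only [LinearMap.sub_apply, LinearMap.neg_apply, LinearMap.dualMap_apply, map_neg,
      LinearMap.smul_apply] at this ⊢
    linear_combination this
  · intro ψ
    ext v
    have := congrArg ψ (hHF v)
    simp only [map_sub, map_smul, map_neg] at this
    simp only [LinearMap.sub_apply, LinearMap.neg_apply, LinearMap.dualMap_apply, map_neg,
      LinearMap.smul_apply] at this ⊢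
    linear_combination this
  · ext v
    exact hφE ⟨v, rfl⟩

/-- With `W k` the span of the weights at least `k`, `E` maps `W 0` onto `W 2` and its kernel lies
in `W 0`. Rank-nullity leaves the weights `0` and `1`. -/
theorem finrank_ker_raising {b : Basis ι ℂ V} {w : ι → ℤ} {E F H : V →ₗ[ℂ] V}
    (hH : ∀ i, H (b i) = (w i : ℂ) • b i)
    (hEF : ∀ v, E (F v) - F (E v) = H v) (hHE : ∀ v, H (E v) - E (H v) = (2 : ℂ) • E v)
    (hHF : ∀ v, H (F v) - F (H v) = -((2 : ℂ) • F v)) :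
    finrank ℂ (LinearMap.ker E) =
      (Finset.univ.filter fun i => w i = 0).card + (Finset.univ.filter fun i => w i = 1).card := by
  classical
  have : FiniteDimensional ℂ V := b.finiteDimensional_of_finite
  let W : ℤ → Submodule ℂ V := fun k => Submodule.span ℂ (Set.range fun i : {i // k ≤ w i} => b i)
  have finrank_W (k : ℤ) : finrank ℂ (W k) = (Finset.univ.filter fun i => k ≤ w i).card := by
    change finrank ℂ (Submodule.span ℂ (Set.range (b ∘ Subtype.val))) = _
    rw [finrank_span_eq_card (b.linearIndependent.comp _ Subtype.val_injective),
      Fintype.card_subtype]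
  have mem_W (k : ℤ) (v : V) : v ∈ W k ↔ ∀ i, w i < k → b.repr v i = 0 := by
    have : W k = Submodule.span ℂ (b '' {i | k ≤ w i}) := by
      simp only [W]; congr 1; ext x; simp
    rw [this, Basis.mem_span_image]
    constructor
    · intro h i hi
      by_contra hne
      exact absurd (h (Finsupp.mem_support_iff.mpr hne)) (by simpa using hi)
    · intro h i hi
      by_contra hne
      exact Finsupp.mem_support_iff.mp hi (h i (by simpa using hne))
  have hmap : (W 0).map E = W 2 := by
    refine le_antisymm ?_ ?_
    · rw [Submodule.map_span_le]
      rintro _ ⟨i, rfl⟩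
      rw [mem_W]
      intro j hj
      have h1 := raising_weightProj hH hHE (w i) (b i)
      rw [weightProj_basis, if_pos rfl] at h1
      rw [h1, repr_weightProj, if_neg]
      have := i.2
      omega
    · rw [Submodule.span_le]
      rintro _ ⟨i, rfl⟩
      have hi := i.2
      obtain ⟨v, hv⟩ := mem_range_raising hH hEF hHE hHF (i := i.1) (by omega)
      -- An arbitrary preimage need not lie in `W 0`; its component of weight `w i - 2` does, and it
      -- is still a preimage.
      refine ⟨weightProj b w (w i - 2) v, ?_, ?_⟩
      · rw [SetLike.mem_coe, mem_W]
        intro j hj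
        rw [repr_weightProj, if_neg (by omega)]
      · rw [raising_weightProj hH hHE, hv, weightProj_basis, if_pos (by ring)]
  have hker : LinearMap.ker E ≤ W 0 := fun v hv => by
    rw [mem_W]
    exact fun i hi => repr_eq_zero_of_raising_eq_zero hH hEF hHE hHF hv hi
  have h1 := (E.domRestrict (W 0)).finrank_range_add_finrank_ker
  rw [LinearMap.range_domRestrict, hmap, finrank_W, finrank_W, LinearMap.ker_domRestrict] at h1
  rw [(Submodule.comapSubtypeEquivOfLe hker).finrank_eq] at h1
  have h2 : (Finset.univ.filter fun i => 0 ≤ w i).card =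
      (Finset.univ.filter fun i => 2 ≤ w i).card + ((Finset.univ.filter fun i => w i = 0).card +
        (Finset.univ.filter fun i => w i = 1).card) := by
    rw [← Finset.card_union_of_disjoint, ← Finset.card_union_of_disjoint]
    · congr 1; ext i; simp; omega
    · rw [Finset.disjoint_left]; intro i; simp; omega
    · rw [Finset.disjoint_left]; intro i; simp; omega
  omega

end Sl2

/-! ### The `sl₂`-triple of derivations on polynomials in the coefficients -/

section Derivations

open MvPolynomial

/-- The polynomial functions of the coefficients of a binary `d`-form. -/
abbrev CoeffPoly (d : ℕ) : Type := MvPolynomial (Fin (d + 1)) ℂ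

/-- The coordinate `a k`, understood as `0` for `k > d`. -/
noncomputable def coord (d k : ℕ) : CoeffPoly d := if h : k < d + 1 then X ⟨k, h⟩ else 0

theorem coord_fin (d : ℕ) (i : Fin (d + 1)) : coord d i = X i := by
  simp [coord, i.2]

/-- The weight of the coordinate `a i`. -/
def weight (d : ℕ) (i : Fin (d + 1)) : ℤ := d - 2 * (i : ℕ)

/-- The raising operator `a i ↦ (d - i + 1) a (i - 1)`. -/
noncomputable def raising (d : ℕ) : Derivation ℂ (CoeffPoly d) (CoeffPoly d) :=
  mkDerivation ℂ fun i => (if (i : ℕ) = 0 then 0 else (d : ℂ) - (i : ℕ) + 1) • coord d (i - 1)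

/-- The lowering operator `a i ↦ (i + 1) a (i + 1)`. -/
noncomputable def lowering (d : ℕ) : Derivation ℂ (CoeffPoly d) (CoeffPoly d) :=
  mkDerivation ℂ fun i => ((i : ℕ) + 1 : ℂ) • coord d (i + 1)

/-- The weight operator `a i ↦ (d - 2 i) a i`. -/
noncomputable def weightOp (d : ℕ) : Derivation ℂ (CoeffPoly d) (CoeffPoly d) :=
  mkDerivation ℂ fun i => (weight d i : ℂ) • X i

variable {d : ℕ}

theorem raising_coord {k : ℕ} (hk : k ≤ d) :
    raising d (coord d k) = (if k = 0 then 0 else (d : ℂ) - k + 1) • coord d (k - 1) := by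
  rw [show coord d k = X ⟨k, by omega⟩ from dif_pos _, raising, mkDerivation_X]

theorem lowering_coord {k : ℕ} (hk : k ≤ d) :
    lowering d (coord d k) = ((k : ℂ) + 1) • coord d (k + 1) := by
  rw [show coord d k = X ⟨k, by omega⟩ from dif_pos _, lowering, mkDerivation_X]

theorem weightOp_coord (k : ℕ) :
    weightOp d (coord d k) = ((d : ℂ) - 2 * k) • coord d k := by
  by_cases hk : k < d + 1
  · rw [show coord d k = X ⟨k, by omega⟩ from dif_pos _, weightOp, mkDerivation_X]
    simp [weight]
  · simp [coord, hk]

theorem lie_raising_lowering : ⁅raising d, lowering d⁆ = weightOp d := by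
  refine derivation_ext fun i => ?_
  have hi : (i : ℕ) ≤ d := by omega
  rw [← coord_fin, Derivation.commutator_apply, lowering_coord hi, raising_coord hi,
    Derivation.map_smul,
    Derivation.map_smul, weightOp_coord, lowering_coord (by omega)]
  -- The formula also holds at `i = d`, where `coord d (d + 1) = 0` and the factor `d - i` vanishes.
  have h1 : raising d (coord d (i + 1)) = ((d : ℂ) - i) • coord d i := by
    rcases hi.lt_or_eq with h | h
    · rw [raising_coord (by omega)]; simp [sub_add]
    · simp [coord, h]
  rw [h1]
  rcases Nat.eq_zero_or_pos (i : ℕ) with h | h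
  · simp [h]
  · rw [if_neg h.ne', Nat.sub_add_cancel h, smul_smul, smul_smul, ← sub_smul, Nat.cast_sub h]
    congr 1
    push_cast
    ring

theorem lie_weightOp_raising : ⁅weightOp d, raising d⁆ = (2 : ℂ) • raising d := by
  refine derivation_ext fun i => ?_
  have hi : (i : ℕ) ≤ d := by omega
  rw [← coord_fin, Derivation.commutator_apply, Derivation.smul_apply, weightOp_coord,
    Derivation.map_smul,
    raising_coord hi, Derivation.map_smul, weightOp_coord]
  rcases Nat.eq_zero_or_pos (i : ℕ) with h | h
  · simp [h]
  · rw [if_neg h.ne', smul_smul, smul_smul, smul_smul, ← sub_smul, Nat.cast_sub h]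
    congr 1
    push_cast
    ring

theorem lie_weightOp_lowering : ⁅weightOp d, lowering d⁆ = -((2 : ℂ) • lowering d) := by
  refine derivation_ext fun i => ?_
  have hi : (i : ℕ) ≤ d := by omega
  rw [← coord_fin, Derivation.commutator_apply, Derivation.neg_apply, Derivation.smul_apply,
    weightOp_coord, Derivation.map_smul, lowering_coord hi, Derivation.map_smul, weightOp_coord,
    smul_smul, smul_smul,
    smul_smul, ← sub_smul, ← neg_smul]
  congr 1
  push_cast
  ring

/-- The weight of a monomial. -/
def monomialWeight (d : ℕ) (l : Fin (d + 1) →₀ ℕ) : ℤ := ∑ i, weight d i * l i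

theorem weightOp_monomial (l : Fin (d + 1) →₀ ℕ) (c : ℂ) :
    weightOp d (monomial l c) = (monomialWeight d l : ℂ) • monomial l c := by
  rw [weightOp, mkDerivation_monomial, Finsupp.sum_fintype _ _ (by simp), monomialWeight,
    Int.cast_sum, Finset.sum_smul, Finset.smul_sum]
  refine Finset.sum_congr rfl fun i _ => ?_
  rcases Nat.eq_zero_or_pos (l i) with h | h
  · simp [h]
  · have hl : l - Finsupp.single i 1 + Finsupp.single i 1 = l :=
      tsub_add_cancel_of_le (by simpa using Nat.one_le_iff_ne_zero.mpr h.ne')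
    have : (monomial (l - Finsupp.single i 1)) (l i : ℂ) * X i = monomial l (l i : ℂ) := by
      rw [X, monomial_mul, hl, mul_one]
    rw [smul_eq_mul, mul_smul_comm, this, smul_monomial, smul_monomial, smul_monomial]
    congr 1
    simp only [smul_eq_mul]
    push_cast
    ring

theorem isHomogeneous_mkDerivation {σ : Type*} {f : σ → MvPolynomial σ ℂ}
    (hf : ∀ i, (f i).IsHomogeneous 1) {n : ℕ} {P : MvPolynomial σ ℂ} (hP : P.IsHomogeneous n) :
    (mkDerivation ℂ f P).IsHomogeneous n := by
  classical
  rw [P.as_sum, map_sum]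
  refine IsHomogeneous.sum _ _ _ fun m hm => ?_
  rw [mkDerivation_monomial, Finsupp.sum, Finset.smul_sum]
  refine IsHomogeneous.sum _ _ _ fun i hi => ?_
  have hdeg : m.degree = n := by
    rw [Finsupp.degree_eq_weight_one]; exact hP (mem_support_iff.mp hm)
  rw [smul_eq_mul, smul_eq_C_mul]
  rw [← zero_add n]
  refine IsHomogeneous.mul (isHomogeneous_C _ _) ?_
  have h1 : (m - Finsupp.single i 1).degree + 1 = n := by
    have : m - Finsupp.single i 1 + Finsupp.single i 1 = m :=
      tsub_add_cancel_of_le (by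
        simpa using Nat.one_le_iff_ne_zero.mpr (Finsupp.mem_support_iff.mp hi))
    rw [← hdeg, ← this]
    simp
  rw [← h1]
  exact IsHomogeneous.mul (isHomogeneous_monomial _ rfl) (hf i)

theorem isHomogeneous_smul_coord (c : ℂ) (k : ℕ) : (c • coord d k).IsHomogeneous 1 := by
  rw [smul_eq_C_mul]
  refine IsHomogeneous.C_mul ?_ c
  rw [coord]
  split_ifs
  · exact isHomogeneous_X _ _
  · exact isHomogeneous_zero _ _ _

/-- A derivation that preserves degrees, restricted to the forms of degree `n`. -/
noncomputable def restrictDegree (D : Derivation ℂ (CoeffPoly d) (CoeffPoly d)) (n : ℕ)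
    (hD : ∀ P : CoeffPoly d, P.IsHomogeneous n → (D P).IsHomogeneous n) :
    homogeneousSubmodule (Fin (d + 1)) ℂ n →ₗ[ℂ] homogeneousSubmodule (Fin (d + 1)) ℂ n :=
  (D : CoeffPoly d →ₗ[ℂ] CoeffPoly d).restrict hD

/-- The exponents of the monomials of degree `n` in the coordinates `a 0, …, a d`. -/
def exponents (d n : ℕ) : Finset (Fin (d + 1) →₀ ℕ) := Finset.univ.finsuppAntidiag n

theorem mem_exponents {n : ℕ} {l : Fin (d + 1) →₀ ℕ} : l ∈ exponents d n ↔ l.degree = n := by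
  rw [exponents, Finset.mem_finsuppAntidiag, Finsupp.degree_eq_sum]
  exact and_iff_left (Finset.subset_univ _)

theorem support_subset_exponents {n : ℕ} {P : CoeffPoly d} (hP : P.IsHomogeneous n)
    {l : Fin (d + 1) →₀ ℕ} (hl : l ∈ P.support) : l ∈ exponents d n := by
  rw [mem_exponents, Finsupp.degree_eq_weight_one]
  exact hP (mem_support_iff.mp hl)

/-- The number of monomials of degree `n` and weight `e` in the coordinates `a 0, …, a d`. -/
def weightMultiplicity (d n : ℕ) (e : ℤ) : ℕ :=
  ((exponents d n).filter fun l => monomialWeight d l = e).card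

/-- The monomials of degree `n`, as a basis. -/
noncomputable def monomialBasis (d n : ℕ) :
    Basis (exponents d n) ℂ (homogeneousSubmodule (Fin (d + 1)) ℂ n) :=
  Basis.mk (v := fun l => ⟨monomial l.1 1, isHomogeneous_monomial _ (mem_exponents.mp l.2)⟩)
    (LinearIndependent.of_comp (homogeneousSubmodule (Fin (d + 1)) ℂ n).subtype
      ((basisMonomials (Fin (d + 1)) ℂ).linearIndependent.comp _ Subtype.val_injective))
    (by
      rintro ⟨P, hP⟩ -
      have : (⟨P, hP⟩ : homogeneousSubmodule (Fin (d + 1)) ℂ n) =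
          ∑ m ∈ P.support.attach, coeff m.1 P • ⟨monomial m.1 1, isHomogeneous_monomial _
            (mem_exponents.mp (support_subset_exponents hP m.2))⟩ := by
        refine Subtype.ext ?_
        simp only [AddSubmonoidClass.coe_finsetSum, SetLike.val_smul, smul_monomial]
        simp only [smul_eq_mul, mul_one]
        rw [Finset.sum_attach P.support fun m => monomial m (coeff m P)]
        exact P.as_sum
      rw [this]
      refine Submodule.sum_mem _ fun m _ => Submodule.smul_mem _ _ (Submodule.subset_span ?_)
      exact ⟨⟨m.1, support_subset_exponents hP m.2⟩, rfl⟩)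

theorem isHomogeneous_raising {n : ℕ} (P : CoeffPoly d) (hP : P.IsHomogeneous n) :
    (raising d P).IsHomogeneous n :=
  isHomogeneous_mkDerivation (fun _ => isHomogeneous_smul_coord _ _) hP

theorem finrank_ker_restrict_raising (d n : ℕ) :
    finrank ℂ (LinearMap.ker (restrictDegree (raising d) n isHomogeneous_raising)) =
      weightMultiplicity d n 0 + weightMultiplicity d n 1 := by
  have hF (P : CoeffPoly d) (hP : P.IsHomogeneous n) : (lowering d P).IsHomogeneous n :=
    isHomogeneous_mkDerivation (fun _ => isHomogeneous_smul_coord _ _) hP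
  have hH (P : CoeffPoly d) (hP : P.IsHomogeneous n) : (weightOp d P).IsHomogeneous n :=
    isHomogeneous_mkDerivation (fun i => by
      rw [← coord_fin]; exact isHomogeneous_smul_coord _ _) hP
  rw [finrank_ker_raising (b := monomialBasis d n) (w := fun l => monomialWeight d l.1)
    (F := restrictDegree (lowering d) n hF) (H := restrictDegree (weightOp d) n hH)]
  · have h (e : ℤ) : (Finset.univ.filter fun l : exponents d n => monomialWeight d l.1 = e).card =
        weightMultiplicity d n e := by
      rw [weightMultiplicity, ← Finset.card_map ⟨_, Subtype.val_injective⟩]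
      congr 1
      ext l
      simp [and_comm]
    rw [h, h]
  · intro l
    refine Subtype.ext ?_
    simp only [monomialBasis, Basis.mk_apply, restrictDegree]
    exact weightOp_monomial _ _
  · intro v
    have h := congrArg (fun D => D v.1) (lie_raising_lowering (d := d))
    rw [Derivation.commutator_apply] at h
    exact Subtype.ext h
  · intro v
    have h := congrArg (fun D => D v.1) (lie_weightOp_raising (d := d))
    rw [Derivation.commutator_apply] at h
    exact Subtype.ext h
  · intro v
    have h := congrArg (fun D => D v.1) (lie_weightOp_lowering (d := d))
    rw [Derivation.commutator_apply] at h
    exact Subtype.ext h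

end Derivations

/-! ### The matrix of the action on coefficient vectors -/

section ActionMatrix

open MvPolynomial

/-- The exponent of the monomial `x₀ ^ (d - i) * x₁ ^ i`. -/
noncomputable def formExponent (d : ℕ) (i : Fin (d + 1)) : Fin 2 →₀ ℕ :=
  Finsupp.single 0 (d - (i : ℕ)) + Finsupp.single 1 (i : ℕ)

theorem formExponent_injective (d : ℕ) : Function.Injective (formExponent d) := fun i j h => by
  have := DFunLike.congr_fun h 1
  exact Fin.ext (by simpa [formExponent] using this)

theorem eq_sum_formCoeff {d : ℕ} {f : MvPolynomial (Fin 2) ℂ} (hf : f.IsHomogeneous d) :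
    f = ∑ j, monomial (formExponent d j) (formCoeff d f j) := by
  classical
  conv_lhs => rw [f.as_sum]
  refine Eq.trans ?_ (Finset.sum_image (s := Finset.univ) (g := formExponent d)
    (f := fun m => monomial m (coeff m f)) (formExponent_injective d).injOn)
  refine Finset.sum_subset ?_ ?_
  · intro m hm
    have hd : m 0 + m 1 = d := by
      have : m.degree = d := by
        rw [Finsupp.degree_eq_weight_one]; exact hf (mem_support_iff.mp hm)
      rwa [Finsupp.degree_eq_sum, Fin.sum_univ_two] at this
    refine Finset.mem_image.mpr ⟨⟨m 1, by omega⟩, Finset.mem_univ _, ?_⟩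
    ext k
    fin_cases k
    · simp [formExponent]; omega
    · simp [formExponent]
  · intro m _ hm
    rw [notMem_support_iff.mp hm, monomial_zero]

/-- The form with given coefficients. -/
noncomputable def formOfCoeff (d : ℕ) (a : Fin (d + 1) → ℂ) : MvPolynomial (Fin 2) ℂ :=
  ∑ j, monomial (formExponent d j) (a j)

theorem isHomogeneous_formOfCoeff (d : ℕ) (a : Fin (d + 1) → ℂ) :
    (formOfCoeff d a).IsHomogeneous d := by
  refine IsHomogeneous.sum _ _ _ fun j _ => isHomogeneous_monomial _ ?_
  rw [Finsupp.degree_eq_sum, Fin.sum_univ_two]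
  simp [formExponent]
  omega

theorem formCoeff_formOfCoeff (d : ℕ) (a : Fin (d + 1) → ℂ) :
    formCoeff d (formOfCoeff d a) = a := by
  classical
  ext i
  change coeff (formExponent d i) _ = _
  rw [formOfCoeff, coeff_sum]
  simp [coeff_monomial, (formExponent_injective d).eq_iff]

theorem aeval_monomial_formExponent {S : Type*} [CommRing S] [Algebra ℂ S] {d : ℕ}
    (x : Fin 2 → S) (j : Fin (d + 1)) (c : ℂ) :
    aeval x (monomial (formExponent d j) c) =
      algebraMap ℂ S c * (x 0 ^ (d - (j : ℕ)) * x 1 ^ (j : ℕ)) := by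
  rw [aeval_monomial, Finsupp.prod_fintype _ _ (by simp), Fin.prod_univ_two]
  simp [formExponent]

/-- Setting `x₀ = 1`, `x₁ = X` loses nothing on forms of known degree. This is why `substMatrix` can
be defined by coefficients of univariate polynomials. -/
theorem formCoeff_eq_coeff_aeval {d : ℕ} {f : MvPolynomial (Fin 2) ℂ} (hf : f.IsHomogeneous d)
    (i : Fin (d + 1)) :
    formCoeff d f i = (aeval ![1, Polynomial.X] f : Polynomial ℂ).coeff i := by
  conv_rhs => rw [eq_sum_formCoeff hf, map_sum]
  simp_rw [aeval_monomial_formExponent]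
  simp [Polynomial.algebraMap_eq, Polynomial.coeff_X_pow, Fin.ext_iff.symm]

variable {R S : Type*} [CommRing R] [CommRing S]

/-- The matrix of the substitution by `h` on binary forms of degree `d`: its `(i, j)` entry is the
coefficient of `x₀ ^ (d - i) * x₁ ^ i` in
`(h₀₀ x₀ + h₀₁ x₁) ^ (d - j) * (h₁₀ x₀ + h₁₁ x₁) ^ j`. -/
noncomputable def substMatrix (d : ℕ) (h : Matrix (Fin 2) (Fin 2) R) :
    Matrix (Fin (d + 1)) (Fin (d + 1)) R := fun i j =>
  ((Polynomial.C (h 0 0) + Polynomial.C (h 0 1) * Polynomial.X) ^ (d - (j : ℕ)) *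
    (Polynomial.C (h 1 0) + Polynomial.C (h 1 1) * Polynomial.X) ^ (j : ℕ)).coeff i

/-- Lets a substitution with polynomial entries, in the group parameter or in the vector variables,
be specialized to numbers. -/
theorem map_substMatrix (φ : R →+* S) (d : ℕ) (h : Matrix (Fin 2) (Fin 2) R)
    (i j : Fin (d + 1)) : φ (substMatrix d h i j) = substMatrix d (h.map φ) i j := by
  rw [substMatrix, ← Polynomial.coeff_map]
  simp [substMatrix]

theorem substMatrix_smul (c : R) (d : ℕ) (h : Matrix (Fin 2) (Fin 2) R) :
    substMatrix d (c • h) = c ^ d • substMatrix d h := by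
  ext i j
  rw [Matrix.smul_apply, smul_eq_mul, substMatrix, substMatrix, ← Polynomial.coeff_C_mul]
  have hd : d = (d - (j : ℕ)) + j := by omega
  have hc : Polynomial.C (c ^ d) = Polynomial.C c ^ (d - (j : ℕ)) * Polynomial.C c ^ (j : ℕ) := by
    rw [← pow_add, ← hd, Polynomial.C_pow]
  rw [hc]
  congr 1
  simp only [Matrix.smul_apply, smul_eq_mul, map_mul]
  rw [mul_mul_mul_comm, ← mul_pow, ← mul_pow]
  ring

/-- The action of `SL₂(ℂ)` on the coefficient vectors of binary `d`-forms. -/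
noncomputable def coeffAct {d : ℕ} (g : Matrix.SpecialLinearGroup (Fin 2) ℂ)
    (a : Fin (d + 1) → ℂ) : Fin (d + 1) → ℂ := (substMatrix d (g⁻¹).val).mulVec a

theorem formCoeff_act {d : ℕ} (g : Matrix.SpecialLinearGroup (Fin 2) ℂ)
    {f : MvPolynomial (Fin 2) ℂ} (hf : f.IsHomogeneous d) :
    formCoeff d (act g f) = coeffAct g (formCoeff d f) := by
  ext i
  rw [formCoeff_eq_coeff_aeval (act_isHomogeneous d g f hf)]
  conv_lhs => rw [eq_sum_formCoeff hf]
  rw [act, aeval_bind₁, map_sum]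
  simp_rw [aeval_monomial_formExponent]
  simp only [Polynomial.finsetSum_coeff, Polynomial.algebraMap_eq, Polynomial.coeff_C_mul,
    coeffAct, Matrix.mulVec, dotProduct]
  refine Finset.sum_congr rfl fun j _ => ?_
  rw [mul_comm, substMatrix]
  simp [Fin.sum_univ_two, Polynomial.algebraMap_eq]

theorem act_mul (g h : Matrix.SpecialLinearGroup (Fin 2) ℂ) (f : MvPolynomial (Fin 2) ℂ) :
    act (g * h) f = act g (act h f) := by
  have : (bind₁ fun i => ∑ j, C (((g * h)⁻¹).val i j) * X j :
      MvPolynomial (Fin 2) ℂ →ₐ[ℂ] MvPolynomial (Fin 2) ℂ) =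
      (bind₁ fun i => ∑ j, C ((g⁻¹).val i j) * X j).comp
        (bind₁ fun i => ∑ j, C ((h⁻¹).val i j) * X j) := by
    refine algHom_ext fun i => ?_
    simp only [AlgHom.comp_apply, bind₁_X_right, mul_inv_rev,
      Matrix.SpecialLinearGroup.coe_mul, Matrix.mul_apply, Fin.sum_univ_two, map_add, map_mul,
      algHom_C, algebraMap_eq]
    ring
  exact DFunLike.congr_fun this f

theorem act_one (f : MvPolynomial (Fin 2) ℂ) : act 1 f = f := by
  have : (bind₁ fun i => ∑ j, C (((1 : Matrix.SpecialLinearGroup (Fin 2) ℂ)⁻¹).val i j) * X j :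
      MvPolynomial (Fin 2) ℂ →ₐ[ℂ] MvPolynomial (Fin 2) ℂ) = AlgHom.id ℂ _ := by
    refine algHom_ext fun i => ?_
    simp [Matrix.one_apply]
  exact DFunLike.congr_fun this f

/-- Every coefficient vector comes from a form, so multiplicativity is inherited from `act` without
any computation with `substMatrix`. -/
theorem coeffAct_mul {d : ℕ} (g h : Matrix.SpecialLinearGroup (Fin 2) ℂ) (a : Fin (d + 1) → ℂ) :
    coeffAct (g * h) a = coeffAct g (coeffAct h a) := by
  have hf := isHomogeneous_formOfCoeff d a
  rw [← formCoeff_formOfCoeff d a, ← formCoeff_act _ hf, ← formCoeff_act _ hf,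
    ← formCoeff_act _ (act_isHomogeneous d h _ hf), act_mul]

theorem coeffAct_one {d : ℕ} (a : Fin (d + 1) → ℂ) : coeffAct 1 a = a := by
  rw [← formCoeff_formOfCoeff d a, ← formCoeff_act _ (isHomogeneous_formOfCoeff d a), act_one]

theorem mem_covariants_iff {d : ℕ} {F : FormPoly d} :
    F ∈ covariants d ↔ ∀ (g : Matrix.SpecialLinearGroup (Fin 2) ℂ) (a : Fin (d + 1) → ℂ)
      (v : Fin 2 → ℂ),
      eval (Sum.elim (coeffAct g a) (g.val.mulVec v)) F = eval (Sum.elim a v) F := by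
  constructor
  · intro hF g a v
    have hf := isHomogeneous_formOfCoeff d a
    have := hF g _ hf v
    rwa [evalAt, evalAt, formCoeff_act _ hf, formCoeff_formOfCoeff] at this
  · intro hF g f hf v
    rw [evalAt, evalAt, formCoeff_act _ hf]
    exact hF g _ v

end ActionMatrix

/-! ### The unipotent group and its infinitesimal action -/

section Unipotent

/-- The upper triangular unipotent matrix, which spans the stabilizer of `(1, 0)`. -/
def unipotent (s : ℂ) : Matrix.SpecialLinearGroup (Fin 2) ℂ :=
  ⟨!![1, s; 0, 1], by simp [Matrix.det_fin_two]⟩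

theorem unipotent_zero : unipotent 0 = 1 := by
  ext i j; fin_cases i <;> fin_cases j <;> simp [unipotent]

/-- The entry is the coefficient of `x^i` in `(1 - s x)^(d - j) x^j`, by the binomial theorem. The
parameter `s` is the `Polynomial.X` of the coefficient ring; the sign comes from the inverse in the
action. -/
theorem substMatrix_unipotent (d : ℕ) (i j : Fin (d + 1)) :
    substMatrix d !![1, -Polynomial.X; 0, (1 : Polynomial ℂ)] i j =
      if (j : ℕ) ≤ i then
        (-Polynomial.X) ^ ((i : ℕ) - j) * (((d - (j : ℕ)).choose ((i : ℕ) - j) : ℕ) : Polynomial ℂ)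
      else 0 := by
  have h : (Polynomial.C 1 + Polynomial.C (-Polynomial.X : Polynomial ℂ) * Polynomial.X) ^
      (d - (j : ℕ)) = ((1 + Polynomial.X) ^ (d - (j : ℕ))).comp
        (Polynomial.C (-Polynomial.X : Polynomial ℂ) * Polynomial.X) := by
    simp
  simp only [substMatrix, Matrix.of_apply, Matrix.cons_val_zero, Matrix.cons_val_one,
    Matrix.cons_val', Matrix.cons_val_fin_one]
  rw [h]
  simp only [map_zero, zero_add, map_one, one_mul, Polynomial.coeff_mul_X_pow',
    Polynomial.comp_C_mul_X_coeff, Polynomial.coeff_one_add_X_pow]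
  split_ifs
  · ring
  · rfl

/-- Rests on `(m + 1) * choose (d - j) (m + 1) = (d - j - m) * choose (d - j) m` with `i = j + m +
1`. The factor `d - i + 1` is the coefficient in `raising`. -/
theorem derivative_substMatrix_unipotent (d : ℕ) (i j : Fin (d + 1)) (k : Fin (d + 1))
    (hk : (i : ℕ) = k + 1) :
    Polynomial.derivative (substMatrix d !![1, -Polynomial.X; 0, (1 : Polynomial ℂ)] i j) =
      -((d : ℂ) - (i : ℕ) + 1) • substMatrix d !![1, -Polynomial.X; 0, (1 : Polynomial ℂ)] k j := by
  rw [substMatrix_unipotent, substMatrix_unipotent]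
  rcases lt_trichotomy (j : ℕ) i with h | h | h
  · obtain ⟨m, hm⟩ := Nat.exists_eq_add_of_lt h
    have hc : ((d - (j : ℕ)).choose (m + 1) : ℂ) * (m + 1) =
        (d - (j : ℕ)).choose m * ((d : ℂ) - (i : ℕ) + 1) := by
      have h1 := Nat.choose_succ_right_eq (d - (j : ℕ)) m
      have h2 : ((d - (j : ℕ) - m : ℕ) : ℂ) = (d : ℂ) - (i : ℕ) + 1 := by
        rw [Nat.cast_sub (by omega), Nat.cast_sub (by omega), hm]
        push_cast
        ring
      rw [← h2]
      exact_mod_cast h1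
    rw [if_pos h.le, if_pos (by omega), show (i : ℕ) - j = m + 1 by omega,
      show (k : ℕ) - j = m by omega, Polynomial.smul_eq_C_mul]
    have hc' := congrArg Polynomial.C hc
    simp only [map_mul, map_add, map_sub, map_natCast, map_one] at hc'
    simp only [Polynomial.derivative_mul, Polynomial.derivative_natCast, Polynomial.derivative_pow,
      Polynomial.derivative_X, map_neg, map_add, map_sub, map_natCast,
      map_one, Nat.add_sub_cancel]
    push_cast
    linear_combination (-(-Polynomial.X) ^ m) * hc'
  · rw [if_pos h.le, if_neg (by omega)]
    simp [h]
  · rw [if_neg (by omega), if_neg (by omega)]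
    simp

end Unipotent

/-! ### Unipotent invariants are the kernel of the raising operator -/

section UnipotentInvariants

open MvPolynomial

variable {d : ℕ}

/-- The values of a polynomial along the orbit of `a` under the unipotent group, as a polynomial
in the group parameter. -/
noncomputable def unipotentOrbit (a : Fin (d + 1) → ℂ) : CoeffPoly d →ₐ[ℂ] Polynomial ℂ :=
  aeval fun i => ∑ j, substMatrix d !![1, -Polynomial.X; 0, (1 : Polynomial ℂ)] i j *
    Polynomial.C (a j)

theorem eval_unipotentOrbit (a : Fin (d + 1) → ℂ) (s : ℂ) (P : CoeffPoly d) :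
    (unipotentOrbit a P).eval s = eval (coeffAct (unipotent s) a) P := by
  have h : ((Polynomial.aeval s).comp (unipotentOrbit a) : CoeffPoly d →ₐ[ℂ] ℂ) =
      aeval (coeffAct (unipotent s) a) := by
    refine algHom_ext fun i => ?_
    have hm : (!![1, -Polynomial.X; 0, (1 : Polynomial ℂ)]).map (Polynomial.evalRingHom s) =
        ((unipotent s)⁻¹).val := by
      rw [Matrix.SpecialLinearGroup.SL2_inv_expl]
      ext i j; fin_cases i <;> fin_cases j <;> simp [unipotent]
    have hs (j : Fin (d + 1)) :
        (substMatrix d !![1, -Polynomial.X; 0, (1 : Polynomial ℂ)] i j).eval s =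
          substMatrix d ((unipotent s)⁻¹).val i j := by
      rw [← hm, ← map_substMatrix]
      rfl
    simp [unipotentOrbit, Polynomial.eval_finsetSum, hs, coeffAct, Matrix.mulVec, dotProduct]
  have := DFunLike.congr_fun h P
  simpa [coe_aeval_eq_eval, Polynomial.coe_aeval_eq_eval] using this

/-- Both sides obey the Leibniz rule along the algebra map `unipotentOrbit a`, so it suffices to
check the coordinates. -/
theorem derivative_unipotentOrbit (a : Fin (d + 1) → ℂ) (P : CoeffPoly d) :
    Polynomial.derivative (unipotentOrbit a P) = -unipotentOrbit a (raising d P) := by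
  induction P using MvPolynomial.induction_on with
  | C c => simp [derivation_C, unipotentOrbit, Polynomial.algebraMap_eq]
  | add P Q hP hQ => simp [hP, hQ]; ring
  | mul_X P i hP =>
    have hX : Polynomial.derivative (unipotentOrbit a (X i)) =
        -unipotentOrbit a (raising d (X i)) := by
      have hi : (i : ℕ) ≤ d := by omega
      rcases Nat.eq_zero_or_pos (i : ℕ) with h | h
      · rw [← coord_fin, raising_coord hi, if_pos h, zero_smul, map_zero, neg_zero, coord_fin]
        simp only [unipotentOrbit, aeval_X, Polynomial.derivative_sum, Polynomial.derivative_mul,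
          Polynomial.derivative_C, mul_zero, add_zero]
        refine Finset.sum_eq_zero fun j _ => ?_
        rw [substMatrix_unipotent]
        split_ifs with hj
        · have : (j : ℕ) = 0 := by omega
          simp [h]
        · simp
      · let k : Fin (d + 1) := ⟨i - 1, by omega⟩
        have hk : (i : ℕ) = k + 1 := by simp [k]; omega
        rw [← coord_fin, raising_coord hi, if_neg h.ne', show (i : ℕ) - 1 = k from rfl, coord_fin,
          coord_fin, map_smul]
        simp only [unipotentOrbit, aeval_X, Polynomial.derivative_sum, Polynomial.derivative_mul,
          Polynomial.derivative_C, mul_zero, add_zero, derivative_substMatrix_unipotent d i _ k hk]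
        rw [Finset.smul_sum, ← Finset.sum_neg_distrib]
        refine Finset.sum_congr rfl fun j _ => ?_
        rw [neg_smul, neg_mul, smul_mul_assoc]
    rw [map_mul, Polynomial.derivative_mul, hP, hX, Derivation.leibniz, map_add, smul_eq_mul,
      smul_eq_mul, map_mul, map_mul]
    ring

/-- Along each orbit `P` is a polynomial in `s`, constant exactly when its derivative vanishes. For
the converse, the derivative is read off at `s = 0`. -/
theorem raising_eq_zero_iff {P : CoeffPoly d} :
    raising d P = 0 ↔ ∀ (s : ℂ) (a : Fin (d + 1) → ℂ),
      eval (coeffAct (unipotent s) a) P = eval a P := by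
  constructor
  · intro h s a
    have h0 := derivative_unipotentOrbit a P
    rw [h, map_zero, neg_zero] at h0
    have h1 := Polynomial.eq_C_of_derivative_eq_zero h0
    have h2 := eval_unipotentOrbit a 0 P
    rw [unipotent_zero, coeffAct_one] at h2
    rw [← eval_unipotentOrbit, ← h2, h1, Polynomial.eval_C, Polynomial.eval_C]
  · intro h
    refine MvPolynomial.funext fun a => ?_
    have h1 : unipotentOrbit a P = Polynomial.C (eval a P) :=
      Polynomial.funext fun s => by rw [eval_unipotentOrbit, h, Polynomial.eval_C]
    have h2 := derivative_unipotentOrbit a P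
    rw [h1, Polynomial.derivative_C, eq_comm, neg_eq_zero] at h2
    have h3 := eval_unipotentOrbit a 0 (raising d P)
    rw [h2, unipotent_zero, coeffAct_one] at h3
    rw [← h3]
    simp

end UnipotentInvariants

/-! ### The source of a covariant determines it -/

section LeadingCoefficient

open MvPolynomial

variable {d : ℕ}

theorem exists_mulVec_eq {v : Fin 2 → ℂ} (hv : v ≠ 0) :
    ∃ g : Matrix.SpecialLinearGroup (Fin 2) ℂ, g.val.mulVec ![1, 0] = v := by
  by_cases h0 : v 0 = 0
  · have h1 : v 1 ≠ 0 := fun h1 => hv (by ext i; fin_cases i <;> simp [h0, h1])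
    refine ⟨⟨!![v 0, -(v 1)⁻¹; v 1, 0], by simp [Matrix.det_fin_two, h1]⟩, ?_⟩
    ext i; fin_cases i <;> simp [Matrix.mulVec, dotProduct]
  · refine ⟨⟨!![v 0, 0; v 1, (v 0)⁻¹], by simp [Matrix.det_fin_two, h0]⟩, ?_⟩
    ext i; fin_cases i <;> simp [Matrix.mulVec, dotProduct]

theorem eq_mul_unipotent {g h : Matrix.SpecialLinearGroup (Fin 2) ℂ}
    (hgh : g.val.mulVec ![1, 0] = h.val.mulVec ![1, 0]) : ∃ s, h = g * unipotent s := by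
  have h1 : (g⁻¹ * h).val.mulVec ![1, 0] = ![1, 0] := by
    rw [Matrix.SpecialLinearGroup.coe_mul, ← Matrix.mulVec_mulVec, ← hgh, Matrix.mulVec_mulVec,
      ← Matrix.SpecialLinearGroup.coe_mul, inv_mul_cancel]
    simp
  have h00 : (g⁻¹ * h).val 0 0 = 1 := by
    simpa [Matrix.mulVec, dotProduct] using congrFun h1 0
  have h10 : (g⁻¹ * h).val 1 0 = 0 := by
    simpa [Matrix.mulVec, dotProduct] using congrFun h1 1
  have hdet := (g⁻¹ * h).2
  rw [Matrix.det_fin_two, h00, h10] at hdet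
  refine ⟨(g⁻¹ * h).val 0 1, ?_⟩
  rw [← inv_mul_eq_iff_eq_mul]
  ext i j
  fin_cases i <;> fin_cases j
  · exact h00
  · rfl
  · exact h10
  · rwa [one_mul, mul_zero, sub_zero] at hdet

/-- Polynomials in the vector variables that agree for all nonzero vectors are equal. -/
theorem eval_eq_of_eval_eq_of_ne_zero {F G : MvPolynomial (Fin 2) ℂ}
    (h : ∀ v : Fin 2 → ℂ, v ≠ 0 → eval v F = eval v G) : F = G := by
  -- The factor `X 0` makes both sides agree at `v = 0` as well.
  have : X 0 * F = X 0 * G := MvPolynomial.funext fun v => by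
    by_cases hv : v = 0
    · simp [hv]
    · simp [h v hv]
  exact mul_left_cancel₀ (X_ne_zero 0) this

/-- Substitution of numbers for the coefficients of the form. -/
noncomputable def fixCoeff (a : Fin (d + 1) → ℂ) : FormPoly d →ₐ[ℂ] MvPolynomial (Fin 2) ℂ :=
  aeval (Sum.elim (fun i => C (a i)) X)

theorem eval_fixCoeff (a : Fin (d + 1) → ℂ) (v : Fin 2 → ℂ) (F : FormPoly d) :
    eval v (fixCoeff a F) = eval (Sum.elim a v) F := by
  have : ((aeval v).comp (fixCoeff a) : FormPoly d →ₐ[ℂ] ℂ) = aeval (Sum.elim a v) := by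
    refine algHom_ext fun i => ?_
    rcases i with i | i <;> simp [fixCoeff]
  simpa [coe_aeval_eq_eval] using DFunLike.congr_fun this F

/-- The restriction of a polynomial function `F(f, v)` to `v = (1, 0)`; on covariants this is the
leading coefficient. -/
noncomputable def leadingCoeff (d : ℕ) : FormPoly d →ₐ[ℂ] CoeffPoly d :=
  aeval (Sum.elim X fun j => C ((![1, 0] : Fin 2 → ℂ) j))

theorem eval_leadingCoeff (a : Fin (d + 1) → ℂ) (F : FormPoly d) :
    eval a (leadingCoeff d F) = eval (Sum.elim a ![1, 0]) F := by
  have : ((aeval a).comp (leadingCoeff d) : FormPoly d →ₐ[ℂ] ℂ) = aeval (Sum.elim a ![1, 0]) := by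
    refine algHom_ext fun i => ?_
    rcases i with i | i <;> simp [leadingCoeff]
  simpa [coe_aeval_eq_eval] using DFunLike.congr_fun this F

theorem mulVec_unipotent (s : ℂ) : (unipotent s).val.mulVec ![1, 0] = ![1, 0] := by
  ext i; fin_cases i <;> simp [unipotent, Matrix.mulVec, dotProduct]

theorem raising_leadingCoeff {F : FormPoly d} (hF : F ∈ covariants d) :
    raising d (leadingCoeff d F) = 0 := by
  refine raising_eq_zero_iff.mpr fun s a => ?_
  rw [eval_leadingCoeff, eval_leadingCoeff]
  have := mem_covariants_iff.mp hF (unipotent s) a ![1, 0]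
  rwa [mulVec_unipotent] at this

theorem eval_covariant {F : FormPoly d} (hF : F ∈ covariants d)
    (g : Matrix.SpecialLinearGroup (Fin 2) ℂ) (a : Fin (d + 1) → ℂ) :
    eval (Sum.elim a (g.val.mulVec ![1, 0])) F = eval (coeffAct g⁻¹ a) (leadingCoeff d F) := by
  have := mem_covariants_iff.mp hF g (coeffAct g⁻¹ a) ![1, 0]
  rwa [← coeffAct_mul, mul_inv_cancel, coeffAct_one, ← eval_leadingCoeff] at this

/-- By transitivity all values at nonzero vectors are values of the source, and a polynomial in `v`
is determined by those. -/
theorem eq_zero_of_leadingCoeff_eq_zero {F : FormPoly d} (hF : F ∈ covariants d)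
    (h : leadingCoeff d F = 0) : F = 0 := by
  refine MvPolynomial.funext fun x => ?_
  have h0 : fixCoeff (x ∘ Sum.inl) F = 0 := by
    refine eval_eq_of_eval_eq_of_ne_zero fun v hv => ?_
    obtain ⟨g, rfl⟩ := exists_mulVec_eq hv
    rw [eval_fixCoeff, eval_covariant hF, h]
    simp
  have h1 := eval_fixCoeff (x ∘ Sum.inl) (x ∘ Sum.inr) F
  rw [h0, Sum.elim_comp_inl_inr] at h1
  rw [← h1]
  simp

theorem isWeightedHomogeneous_aeval {σ τ : Type*} {w : σ → ℕ} {w' : τ → ℕ}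
    {φ : σ → MvPolynomial τ ℂ} (hφ : ∀ i, IsWeightedHomogeneous w' (φ i) (w i)) {n : ℕ}
    {P : MvPolynomial σ ℂ} (hP : IsWeightedHomogeneous w P n) :
    IsWeightedHomogeneous w' (aeval φ P) n := by
  rw [P.as_sum, map_sum]
  refine IsWeightedHomogeneous.sum _ _ _ fun m hm => ?_
  rw [aeval_monomial, algebraMap_eq]
  refine IsWeightedHomogeneous.C_mul ?_ _
  rw [← hP (mem_support_iff.mp hm), Finsupp.weight_apply]
  exact IsWeightedHomogeneous.prod _ _ _ fun i _ => (hφ i).pow _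

end LeadingCoefficient

/-! ### Every homogeneous unipotent invariant is a source -/

section Sources

open MvPolynomial

variable {d : ℕ}

/-- The weights that measure the degree in the coefficients of the form. -/
abbrev coeffDegree (d : ℕ) : Fin (d + 1) ⊕ Fin 2 → ℕ := Sum.elim (fun _ => 1) (fun _ => 0)

/-- The polynomial `P` in the coefficients of the form that is obtained from `f` by the
substitution `h`, whose entries are polynomials in the vector variables. -/
noncomputable def substForm (h : Matrix (Fin 2) (Fin 2) (MvPolynomial (Fin 2) ℂ)) :
    CoeffPoly d →ₐ[ℂ] FormPoly d :=
  aeval fun i => ∑ j, rename Sum.inr (substMatrix d h i j) * X (Sum.inl j)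

theorem eval_substForm (h : Matrix (Fin 2) (Fin 2) (MvPolynomial (Fin 2) ℂ))
    (a : Fin (d + 1) → ℂ) (v : Fin 2 → ℂ) (P : CoeffPoly d) :
    eval (Sum.elim a v) (substForm h P) =
      eval ((substMatrix d (h.map (eval v))).mulVec a) P := by
  have : ((aeval (Sum.elim a v)).comp (substForm h) : CoeffPoly d →ₐ[ℂ] ℂ) =
      aeval ((substMatrix d (h.map (eval v))).mulVec a) := by
    refine algHom_ext fun i => ?_
    simp [substForm, eval_rename, map_substMatrix, Matrix.mulVec, dotProduct]
  simpa [coe_aeval_eq_eval] using DFunLike.congr_fun this P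

theorem isWeightedHomogeneous_rename_inr (p : MvPolynomial (Fin 2) ℂ) :
    IsWeightedHomogeneous (coeffDegree d) (rename Sum.inr p) 0 := by
  rw [rename_eq_aeval]
  refine isWeightedHomogeneous_aeval (w := fun _ => 0) 
    (fun i => isWeightedHomogeneous_X ℂ (coeffDegree d) (Sum.inr i)) ?_
  intro m _
  simp [Finsupp.weight_apply]

theorem isWeightedHomogeneous_substForm (h : Matrix (Fin 2) (Fin 2) (MvPolynomial (Fin 2) ℂ))
    {n : ℕ} {P : CoeffPoly d} (hP : P.IsHomogeneous n) :
    IsWeightedHomogeneous (coeffDegree d) (substForm h P) n := by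
  refine isWeightedHomogeneous_aeval (w := 1) (fun i => ?_) hP
  refine IsWeightedHomogeneous.sum _ _ _ fun j _ => ?_
  rw [← zero_add ((1 : Fin (d + 1) → ℕ) i)]
  exact (isWeightedHomogeneous_rename_inr _).mul (isWeightedHomogeneous_X _ _ _)

theorem isHomogeneous_leadingCoeff {n : ℕ} {F : FormPoly d}
    (hF : IsWeightedHomogeneous (coeffDegree d) F n) : (leadingCoeff d F).IsHomogeneous n := by
  refine isWeightedHomogeneous_aeval (fun i => ?_) hF
  rcases i with i | i
  · exact isHomogeneous_X _ _
  · exact isHomogeneous_C _ _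

theorem eval_smul_of_isHomogeneous {σ : Type*} {n : ℕ} {P : MvPolynomial σ ℂ}
    (hP : P.IsHomogeneous n) (c : ℂ) (x : σ → ℂ) : eval (c • x) P = c ^ n * eval x P := by
  rw [eval_eq, eval_eq, Finset.mul_sum]
  refine Finset.sum_congr rfl fun m hm => ?_
  have hdeg : m.degree = n := by
    rw [Finsupp.degree_eq_weight_one]; exact hP (mem_support_iff.mp hm)
  simp only [Pi.smul_apply, smul_eq_mul, mul_pow, Finset.prod_mul_distrib]
  rw [Finset.prod_pow_eq_pow_sum, ← Finsupp.degree_apply, hdeg]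
  ring

/-- Makes `P(g⁻¹ a)` a function of `g e₁` alone: two choices of `g` differ by a unipotent factor,
which `P` does not see. -/
theorem eval_coeffAct_inv_congr {P : CoeffPoly d} (hP : raising d P = 0)
    {g h : Matrix.SpecialLinearGroup (Fin 2) ℂ}
    (hgh : g.val.mulVec ![1, 0] = h.val.mulVec ![1, 0]) (a : Fin (d + 1) → ℂ) :
    eval (coeffAct g⁻¹ a) P = eval (coeffAct h⁻¹ a) P := by
  obtain ⟨s, rfl⟩ := eq_mul_unipotent hgh
  rw [← raising_eq_zero_iff.mp hP s (coeffAct (g * unipotent s)⁻¹ a), ← coeffAct_mul, mul_inv_rev,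
    mul_inv_cancel_left]

/-- `substMatrix d` has degree `d` in the entries and `P` has degree `n`, so scaling a group element
by `c` costs `c ^ (d * n)`. This clears the denominators from matrices of determinant one. -/
theorem eval_substForm_of_smul {n : ℕ} {P : CoeffPoly d} (hP : P.IsHomogeneous n)
    (h : Matrix (Fin 2) (Fin 2) (MvPolynomial (Fin 2) ℂ)) (a : Fin (d + 1) → ℂ) (v : Fin 2 → ℂ)
    (c : ℂ) (g : Matrix.SpecialLinearGroup (Fin 2) ℂ) (hg : h.map (eval v) = c • g.val) :
    eval (Sum.elim a v) (substForm h P) = c ^ (d * n) * eval (coeffAct g⁻¹ a) P := by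
  rw [eval_substForm, hg, substMatrix_smul, Matrix.smul_mulVec, eval_smul_of_isHomogeneous hP,
    pow_mul, coeffAct, inv_inv]

/-- The substituted matrix is `v₀` times `!![v₀, 0; v₁, v₀⁻¹]`, a group element taking `e₁` to `v`.
-/
theorem eval_substForm_left {n : ℕ} {P : CoeffPoly d} (hP : P.IsHomogeneous n)
    (hE : raising d P = 0) (a : Fin (d + 1) → ℂ) {v : Fin 2 → ℂ} (hv : v 0 ≠ 0)
    {g : Matrix.SpecialLinearGroup (Fin 2) ℂ} (hg : g.val.mulVec ![1, 0] = v) :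
    eval (Sum.elim a v) (substForm !![X 0 ^ 2, 0; X 0 * X 1, 1] P) =
      v 0 ^ (d * n) * eval (coeffAct g⁻¹ a) P := by
  let g' : Matrix.SpecialLinearGroup (Fin 2) ℂ :=
    ⟨!![v 0, 0; v 1, (v 0)⁻¹], by simp [Matrix.det_fin_two, hv]⟩
  have hg' : g'.val.mulVec ![1, 0] = g.val.mulVec ![1, 0] := by
    rw [hg]
    ext i; fin_cases i <;> simp [g', Matrix.mulVec, dotProduct]
  rw [eval_substForm_of_smul hP _ a v (v 0) g', eval_coeffAct_inv_congr hE hg' a]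
  ext i j; fin_cases i <;> fin_cases j <;> simp [g', hv, pow_two, mul_comm]

/-- The counterpart for `v₁ ≠ 0`: the matrix is `v₁` times `!![v₀, -v₁⁻¹; v₁, 0]`. -/
theorem eval_substForm_right {n : ℕ} {P : CoeffPoly d} (hP : P.IsHomogeneous n)
    (hE : raising d P = 0) (a : Fin (d + 1) → ℂ) {v : Fin 2 → ℂ} (hv : v 1 ≠ 0)
    {g : Matrix.SpecialLinearGroup (Fin 2) ℂ} (hg : g.val.mulVec ![1, 0] = v) :
    eval (Sum.elim a v) (substForm !![X 0 * X 1, -1; X 1 ^ 2, 0] P) =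
      v 1 ^ (d * n) * eval (coeffAct g⁻¹ a) P := by
  let g' : Matrix.SpecialLinearGroup (Fin 2) ℂ :=
    ⟨!![v 0, -(v 1)⁻¹; v 1, 0], by simp [Matrix.det_fin_two, hv]⟩
  have hg' : g'.val.mulVec ![1, 0] = g.val.mulVec ![1, 0] := by
    rw [hg]
    ext i; fin_cases i <;> simp [g', Matrix.mulVec, dotProduct]
  rw [eval_substForm_of_smul hP _ a v (v 1) g', eval_coeffAct_inv_congr hE hg' a]
  ext i j; fin_cases i <;> fin_cases j <;> simp [g', hv, pow_two, mul_comm]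

/-- The two charts agree where both coordinates are nonzero, so `x₁^(dn) Q₀ = x₀^(dn) Q₁`. As `x₀`
is a prime not dividing `x₁`, `x₀^(dn)` divides `Q₀`; the quotient is the polynomial sought. -/
theorem exists_eq_X_pow_mul {n : ℕ} {P : CoeffPoly d} (hP : P.IsHomogeneous n)
    (hE : raising d P = 0) :
    ∃ F : FormPoly d, substForm !![X 0 ^ 2, 0; X 0 * X 1, 1] P = X (Sum.inr 0) ^ (d * n) * F ∧
      substForm !![X 0 * X 1, -1; X 1 ^ 2, 0] P = X (Sum.inr 1) ^ (d * n) * F := by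
  generalize hQ₀ : (substForm !![X 0 ^ 2, 0; X 0 * X 1, 1] P : FormPoly d) = Q₀
  generalize hQ₁ : (substForm !![X 0 * X 1, -1; X 1 ^ 2, 0] P : FormPoly d) = Q₁
  have hcross : (X (Sum.inr 1) : FormPoly d) ^ (d * n) * Q₀ = X (Sum.inr 0) ^ (d * n) * Q₁ := by
    have h01 : (X (Sum.inr 0) * X (Sum.inr 1) : FormPoly d) ≠ 0 :=
      mul_ne_zero (X_ne_zero _) (X_ne_zero _)
    -- Multiplying by `x₀ x₁` removes the points where a coordinate vanishes from the check.
    refine mul_left_cancel₀ h01 (MvPolynomial.funext fun x => ?_)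
    by_cases h0 : x (Sum.inr 0) = 0
    · simp [h0]
    by_cases h1 : x (Sum.inr 1) = 0
    · simp [h1]
    obtain ⟨g, hg⟩ := exists_mulVec_eq (v := x ∘ Sum.inr) fun h => h0 (congrFun h 0)
    have e0 := eval_substForm_left hP hE (x ∘ Sum.inl) h0 hg
    have e1 := eval_substForm_right hP hE (x ∘ Sum.inl) h1 hg
    rw [Sum.elim_comp_inl_inr] at e0 e1
    rw [hQ₀] at e0
    rw [hQ₁] at e1
    simp only [map_mul, map_pow, eval_X, e0, e1, Function.comp_apply]
    ring
  have hprime : Prime (X (Sum.inr 0) : FormPoly d) := X_prime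
  obtain ⟨F, hF⟩ : X (Sum.inr 0) ^ (d * n) ∣ Q₀ := by
    refine hprime.pow_dvd_of_dvd_mul_left _ (fun h => ?_) ⟨Q₁, hcross⟩
    have h2 := hprime.dvd_of_dvd_pow h
    rw [X_dvd_X] at h2
    simp at h2
  refine ⟨F, hF, ?_⟩
  rw [hF, mul_left_comm] at hcross
  exact (mul_left_cancel₀ (pow_ne_zero _ (X_ne_zero _)) hcross).symm

/-- The quotient `F` satisfies `F(a, g e₁) = P(g⁻¹ a)` for every `g`, and covariance at nonzero
vectors is then `(k g)⁻¹ k = g⁻¹`. -/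
theorem exists_covariant_of_raising_eq_zero {n : ℕ} {P : CoeffPoly d} (hP : P.IsHomogeneous n)
    (hE : raising d P = 0) :
    ∃ F ∈ covariants d, IsWeightedHomogeneous (coeffDegree d) F n ∧ leadingCoeff d F = P := by
  obtain ⟨F, hF₀, hF₁⟩ := exists_eq_X_pow_mul hP hE
  have eval_F (a : Fin (d + 1) → ℂ) (g : Matrix.SpecialLinearGroup (Fin 2) ℂ) :
      eval (Sum.elim a (g.val.mulVec ![1, 0])) F = eval (coeffAct g⁻¹ a) P := by
    by_cases h0 : g.val.mulVec ![1, 0] 0 = 0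
    · have h1 : g.val.mulVec ![1, 0] 1 ≠ 0 := fun h1 => by
        have hdet := g.2
        have h0' : g.val 0 0 = 0 := by simpa [Matrix.mulVec, dotProduct] using h0
        have h1' : g.val 1 0 = 0 := by simpa [Matrix.mulVec, dotProduct] using h1
        rw [Matrix.det_fin_two, h0', h1'] at hdet
        simp at hdet
      have := eval_substForm_right hP hE a h1 rfl
      rw [hF₁, map_mul, map_pow, eval_X, Sum.elim_inr] at this
      exact mul_left_cancel₀ (pow_ne_zero _ h1) this
    · have := eval_substForm_left hP hE a h0 rfl
      rw [hF₀, map_mul, map_pow, eval_X, Sum.elim_inr] at this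
      exact mul_left_cancel₀ (pow_ne_zero _ h0) this
  refine ⟨F, mem_covariants_iff.mpr fun k a v => ?_, ?_, ?_⟩
  · have key (g : Matrix.SpecialLinearGroup (Fin 2) ℂ) :
        eval (Sum.elim (coeffAct k a) (k.val.mulVec (g.val.mulVec ![1, 0]))) F =
          eval (Sum.elim a (g.val.mulVec ![1, 0])) F := by
      rw [Matrix.mulVec_mulVec, ← Matrix.SpecialLinearGroup.coe_mul, eval_F, eval_F, ← coeffAct_mul,
        mul_inv_rev, inv_mul_cancel_right]
    have hlin (v : Fin 2 → ℂ) : eval v (aeval (fun i => ∑ j, C (k.val i j) * X j)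
        (fixCoeff (coeffAct k a) F)) = eval (Sum.elim (coeffAct k a) (k.val.mulVec v)) F := by
      have h : (aeval v).comp (aeval fun i => ∑ j, C (k.val i j) * X j) =
          (aeval (k.val.mulVec v) : MvPolynomial (Fin 2) ℂ →ₐ[ℂ] ℂ) := by
        refine algHom_ext fun i => ?_
        fin_cases i <;> simp
      rw [← eval_fixCoeff]
      simpa [coe_aeval_eq_eval] using DFunLike.congr_fun h (fixCoeff (coeffAct k a) F)
    -- Covariance is stated as an identity of polynomials in `v`, so that it extends from nonzero
    -- vectors to `v = 0`.
    have heq : aeval (fun i => ∑ j, C (k.val i j) * X j) (fixCoeff (coeffAct k a) F) =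
        fixCoeff a F := by
      refine eval_eq_of_eval_eq_of_ne_zero fun v hv => ?_
      obtain ⟨g, rfl⟩ := exists_mulVec_eq hv
      rw [hlin, key, eval_fixCoeff]
    rw [← hlin, heq, eval_fixCoeff]
  · intro m hm
    -- The power of `x₀` only shifts exponents of a vector variable, which `coeffDegree` ignores, so
    -- `F` inherits its degree from `substForm`.
    have h1 : coeff (m + Finsupp.single (Sum.inr 0) (d * n))
        (substForm !![X 0 ^ 2, 0; X 0 * X 1, 1] P : FormPoly d) = coeff m F := by
      rw [hF₀, mul_comm (X _ ^ _), X_pow_eq_monomial, coeff_mul_monomial, mul_one]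
    have h2 := isWeightedHomogeneous_substForm !![X 0 ^ 2, 0; X 0 * X 1, 1] hP (h1 ▸ hm)
    rw [map_add, Finsupp.weight_single] at h2
    simpa using h2
  · refine MvPolynomial.funext fun a => ?_
    have := eval_F a 1
    rw [inv_one, coeffAct_one] at this
    rw [eval_leadingCoeff, ← this]
    simp

end Sources

/-! ### Dimensions of the spaces of covariants -/

section Dimension

open MvPolynomial

/-- The leading coefficient of a covariant of degree `n`. -/
noncomputable def leadingCoeffMap (d n : ℕ) : covariantsOfDegree d n →ₗ[ℂ]
    LinearMap.ker (restrictDegree (raising d) n isHomogeneous_raising) where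
  toFun F := ⟨⟨leadingCoeff d F.1, isHomogeneous_leadingCoeff F.2.2⟩,
    Subtype.ext (raising_leadingCoeff F.2.1)⟩
  map_add' F G := Subtype.ext (Subtype.ext (map_add (leadingCoeff d) F.1 G.1))
  map_smul' c F := Subtype.ext (Subtype.ext (map_smul (leadingCoeff d) c F.1))

theorem leadingCoeffMap_bijective (d n : ℕ) : Function.Bijective (leadingCoeffMap d n) := by
  constructor
  · intro F G h
    have h1 : leadingCoeff d F.1 = leadingCoeff d G.1 := congrArg (fun x => (x.1.1 : CoeffPoly d)) h
    refine Subtype.ext (sub_eq_zero.mp (eq_zero_of_leadingCoeff_eq_zero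
      ((covariants d).sub_mem F.2.1 G.2.1) ?_))
    rw [map_sub, h1, sub_self]
  · rintro ⟨⟨P, hP⟩, hE⟩
    obtain ⟨F, hF, hFn, rfl⟩ := exists_covariant_of_raising_eq_zero hP (congrArg Subtype.val hE)
    exact ⟨⟨F, hF, hFn⟩, rfl⟩

/-- A covariant is determined by its leading coefficient, which is an arbitrary polynomial killed
by the raising operator. -/
noncomputable def covariantsEquiv (d n : ℕ) : covariantsOfDegree d n ≃ₗ[ℂ]
    LinearMap.ker (restrictDegree (raising d) n isHomogeneous_raising) :=
  LinearEquiv.ofBijective (leadingCoeffMap d n) (leadingCoeffMap_bijective d n)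

theorem finite_covariantsOfDegree (d n : ℕ) : Module.Finite ℂ (covariantsOfDegree d n) := by
  have := (monomialBasis d n).finiteDimensional_of_finite
  exact Module.Finite.equiv (covariantsEquiv d n).symm

theorem coeff_poincareSeries (d n : ℕ) : PowerSeries.coeff n (poincareSeries d) =
    (weightMultiplicity d n 0 : ℤ) + weightMultiplicity d n 1 := by
  rw [poincareSeries, PowerSeries.coeff_mk, (covariantsEquiv d n).finrank_eq,
    finrank_ker_restrict_raising, Nat.cast_add]

end Dimension

/-! ### Coefficients of the two-variable generating function -/

section GeneratingFunction

open MvPowerSeries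

/-- The geometric series `1 / (1 - t z ^ m)`. -/
noncomputable def geomSeries (m : ℕ) : MvPowerSeries (Fin 2) ℂ :=
  fun e => if e 1 = m * e 0 then 1 else 0

theorem geomSeries_mul (m : ℕ) : geomSeries m * (1 - X 0 * X 1 ^ m) = 1 := by
  classical
  have hX : (X 0 * X 1 ^ m : MvPowerSeries (Fin 2) ℂ) =
      monomial (Finsupp.single 0 1 + Finsupp.single 1 m) 1 := by
    rw [X_pow_eq, X_def, monomial_mul_monomial, mul_one]
  rw [mul_sub, mul_one, hX]
  ext e
  rw [map_sub, coeff_mul_monomial, coeff_one, mul_one]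
  change (if e 1 = m * e 0 then (1 : ℂ) else 0) - (if _ then
    (if (e - _ : Fin 2 →₀ ℕ) 1 = m * (e - _ : Fin 2 →₀ ℕ) 0 then (1 : ℂ) else 0) else 0) = _
  have he : e = 0 ↔ e 0 = 0 ∧ e 1 = 0 := by
    simp [Finsupp.ext_iff, Fin.forall_fin_two]
  have hle : Finsupp.single 0 1 + Finsupp.single 1 m ≤ e ↔ 1 ≤ e 0 ∧ m ≤ e 1 := by
    simp [Finsupp.le_def, Fin.forall_fin_two]
  simp only [hle, he, Finsupp.tsub_apply, Finsupp.add_apply]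
  simp only [Fin.isValue, Finsupp.single_eq_same, ne_eq, one_ne_zero, not_false_eq_true,
    Finsupp.single_eq_of_ne, zero_add, zero_ne_one, add_zero]
  rcases Nat.eq_zero_or_pos (e 0) with h0 | h0
  · simp [h0]
  -- For positive `t`-exponent, the support line `e 1 = m * e 0` is stable under the shift by `(1,
  -- m)`, so the two terms cancel.
  · obtain ⟨k, hk⟩ := Nat.exists_eq_add_of_le h0
    have h1 : m * e 0 = m + m * k := by rw [hk]; ring
    have h2 : e 0 - 1 = k := by omega
    rw [h1, h2]
    by_cases hm : m ≤ e 1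
    · have : (e 1 = m + m * k) ↔ (e 1 - m = m * k) := by omega
      simp [this, Nat.one_le_iff_ne_zero, hm, h0.ne']
    · have : e 1 ≠ m + m * k := by omega
      simp [this, hm, h0.ne']

/-- Expanding the product means choosing `t^(l k) z^(2 k l k)` from each factor; such a choice is an
exponent vector `l`. -/
theorem coeff_prod_geomSeries (d n e : ℕ) :
    coeff (Finsupp.single 0 n + Finsupp.single 1 e)
      (∏ k : Fin (d + 1), geomSeries (2 * (k : ℕ))) =
      (((exponents d n).filter fun l => ∑ k : Fin (d + 1), 2 * (k : ℕ) * l k = e).card : ℂ) := by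
  classical
  rw [coeff_prod]
  have h (L : Fin (d + 1) →₀ (Fin 2 →₀ ℕ)) :
      ∏ k, coeff (L k) (geomSeries (2 * (k : ℕ))) =
        if ∀ k, L k 1 = 2 * (k : ℕ) * L k 0 then (1 : ℂ) else 0 := by
    change (∏ k, if L k 1 = 2 * (k : ℕ) * L k 0 then (1 : ℂ) else 0) = _
    rw [Fintype.prod_boole]
    congr
  simp_rw [h]
  rw [Finset.sum_boole]
  congr 1
  refine Finset.card_bij (fun L _ => L.mapRange (fun x => x 0) rfl) ?_ ?_ ?_
  · intro L hL
    rw [Finset.mem_filter, Finset.mem_finsuppAntidiag] at hL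
    obtain ⟨⟨hsum, -⟩, hL⟩ := hL
    rw [Finset.mem_filter, exponents, Finset.mem_finsuppAntidiag]
    have e0 := DFunLike.congr_fun hsum 0
    have e1 := DFunLike.congr_fun hsum 1
    rw [Finsupp.finsetSum_apply] at e0 e1
    refine ⟨⟨?_, Finset.subset_univ _⟩, ?_⟩
    · exact (show ∑ k, L k 0 = n by simpa using e0)
    · simpa [hL] using e1
  · intro L hL M hM hLM
    rw [Finset.mem_filter] at hL hM
    ext k j
    have h0 : L k 0 = M k 0 := DFunLike.congr_fun hLM k
    fin_cases j
    · exact h0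
    · exact (hL.2 k).trans (by rw [h0]; exact (hM.2 k).symm)
  · intro l hl
    rw [Finset.mem_filter, exponents, Finset.mem_finsuppAntidiag] at hl
    obtain ⟨⟨hn, -⟩, he⟩ := hl
    refine ⟨Finsupp.equivFunOnFinite.symm fun k =>
      Finsupp.single 0 (l k) + Finsupp.single 1 (2 * (k : ℕ) * l k), ?_, ?_⟩
    · rw [Finset.mem_filter, Finset.mem_finsuppAntidiag]
      refine ⟨⟨?_, Finset.subset_univ _⟩, fun k => by simp⟩
      ext j
      rw [Finsupp.finsetSum_apply]
      fin_cases j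
      · simpa using hn
      · simpa using he
    · ext k
      simp

theorem covariantGenFun_eq (d : ℕ) :
    covariantGenFun d = (1 + X 1) * ∏ k : Fin (d + 1), geomSeries (2 * (k : ℕ)) := by
  rw [covariantGenFun]
  congr 1
  rw [MvPowerSeries.inv_eq_iff_mul_eq_one, Finset.prod_range, ← Finset.prod_mul_distrib]
  · exact Finset.prod_eq_one fun k _ => geomSeries_mul _
  · simp [map_prod]

theorem monomialWeight_of_mem_exponents {d n : ℕ} {l : Fin (d + 1) →₀ ℕ} (hl : l ∈ exponents d n) :
    monomialWeight d l = d * n - ((∑ k : Fin (d + 1), 2 * (k : ℕ) * l k : ℕ) : ℤ) := by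
  rw [mem_exponents, Finsupp.degree_eq_sum] at hl
  rw [← hl]
  simp only [monomialWeight, weight, sub_mul, Finset.sum_sub_distrib, ← Finset.mul_sum]
  push_cast
  rfl

/-- At `t^n z^(dn)`, the summand `1` of `1 + z` counts `∑ 2 k l k = dn`, which is weight `0`, and
the summand `z` counts `∑ 2 k l k = dn - 1`, which is weight `1`. -/
theorem coeff_Psi_covariantGenFun (d n : ℕ) :
    PowerSeries.coeff n (Psi 1 d (covariantGenFun d)) =
      (weightMultiplicity d n 0 : ℂ) + weightMultiplicity d n 1 := by
  classical
  have h0 : weightMultiplicity d n 0 =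
      ((exponents d n).filter fun l => ∑ k : Fin (d + 1), 2 * (k : ℕ) * l k = d * n).card := by
    rw [weightMultiplicity]
    congr 1
    refine Finset.filter_congr fun l hl => ?_
    rw [monomialWeight_of_mem_exponents hl, ← Nat.cast_mul]
    omega
  have h1 : coeff (Finsupp.single 0 n + Finsupp.single 1 (d * n))
      (X 1 * ∏ k : Fin (d + 1), geomSeries (2 * (k : ℕ))) = (weightMultiplicity d n 1 : ℂ) := by
    rw [X_def, mul_comm (monomial _ _), coeff_mul_monomial, mul_one, weightMultiplicity]
    have hle : Finsupp.single (1 : Fin 2) 1 ≤ Finsupp.single 0 n + Finsupp.single 1 (d * n) ↔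
        1 ≤ d * n := by
      simp [Finsupp.le_def, Fin.forall_fin_two]
    by_cases hdn : 1 ≤ d * n
    · rw [if_pos (hle.mpr hdn), add_tsub_assoc_of_le (by simpa using hdn), ← Finsupp.single_tsub,
        coeff_prod_geomSeries]
      congr 2
      refine Finset.filter_congr fun l hl => ?_
      rw [monomialWeight_of_mem_exponents hl, ← Nat.cast_mul]
      omega
    -- If `dn = 0`, the shifted exponent does not exist, and no monomial has positive weight.
    · rw [if_neg (mt hle.mp hdn), eq_comm, Nat.cast_eq_zero, Finset.card_eq_zero,
        Finset.filter_eq_empty_iff]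
      intro l hl
      rw [monomialWeight_of_mem_exponents hl, ← Nat.cast_mul]
      omega
  simp only [Psi, LinearMap.coe_mk, AddHom.coe_mk, PowerSeries.coeff_mk]
  rw [one_mul, covariantGenFun_eq, add_mul, one_mul, map_add, coeff_prod_geomSeries, ← h0, h1]

end GeneratingFunction

/-! ### Termwise evaluation of the contour integral -/

section Contour

/-- Induction splits off one variable. Absolute summability is carried along because multiplying two
series requires it. -/
theorem summable_and_hasSum_prod_geometric (D : ℕ) (y : Fin D → ℂ) (hy : ∀ i, ‖y i‖ < 1) :
    Summable (fun l : Fin D → ℕ => ‖∏ i, y i ^ l i‖) ∧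
      HasSum (fun l : Fin D → ℕ => ∏ i, y i ^ l i) (∏ i, (1 - y i))⁻¹ := by
  induction D with
  | zero => exact ⟨Summable.of_finite, by simp⟩
  | succ D ih =>
    obtain ⟨hs, hS⟩ := ih (fun i => y i.succ) fun i => hy i.succ
    have gs : Summable fun n : ℕ => ‖y 0 ^ n‖ := by
      simpa [norm_pow] using summable_geometric_of_lt_one (norm_nonneg _) (hy 0)
    have gS := hasSum_geometric_of_norm_lt_one (hy 0)
    have he (x : ℕ × (Fin D → ℕ)) : ∏ i, y i ^ Fin.consEquiv (fun _ : Fin (D + 1) => ℕ) x i =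
        y 0 ^ x.1 * ∏ i, y i.succ ^ x.2 i := by
      simp [Fin.consEquiv, Fin.prod_univ_succ]
    constructor
    · refine (Fin.consEquiv fun _ : Fin (D + 1) => ℕ).summable_iff.mp ?_
      simp only [Function.comp_def, he]
      exact Summable.mul_norm (f := fun n : ℕ => y 0 ^ n)
        (g := fun l : Fin D → ℕ => ∏ i, y i.succ ^ l i) gs hs
    · refine (Fin.consEquiv fun _ : Fin (D + 1) => ℕ).hasSum_iff.mp ?_
      simp only [Function.comp_def, he]
      rw [Fin.prod_univ_succ, mul_inv]
      exact HasSum.mul (f := fun n : ℕ => y 0 ^ n)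
        (g := fun l : Fin D → ℕ => ∏ i, y i.succ ^ l i) gS hS
        (summable_mul_of_summable_norm (f := fun n : ℕ => y 0 ^ n)
          (g := fun l : Fin D → ℕ => ∏ i, y i.succ ^ l i) gs hs)

theorem summable_norm_prod_pow {D : ℕ} {y : Fin D → ℂ} (hy : ∀ i, ‖y i‖ < 1) :
    Summable (fun l : Fin D →₀ ℕ => ‖∏ i, y i ^ l i‖) :=
  (Equiv.summable_iff (f := fun l : Fin D → ℕ => ‖∏ i, y i ^ l i‖)
    Finsupp.equivFunOnFinite).mpr (summable_and_hasSum_prod_geometric D y hy).1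

theorem hasSum_prod_pow {D : ℕ} {y : Fin D → ℂ} (hy : ∀ i, ‖y i‖ < 1) :
    HasSum (fun l : Fin D →₀ ℕ => ∏ i, y i ^ l i) (∏ i, (1 - y i))⁻¹ :=
  (Equiv.hasSum_iff (f := fun l : Fin D → ℕ => ∏ i, y i ^ l i)
    Finsupp.equivFunOnFinite).mpr (summable_and_hasSum_prod_geometric D y hy).2

theorem zpow_sum₀ {ι : Type*} {z : ℂ} (hz : z ≠ 0) (s : Finset ι) (f : ι → ℤ) :
    z ^ (∑ i ∈ s, f i) = ∏ i ∈ s, z ^ f i := by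
  classical
  induction s using Finset.induction_on with
  | empty => simp
  | insert i s hi ih => rw [Finset.sum_insert hi, Finset.prod_insert hi, zpow_add₀ hz, ih]

variable {d : ℕ} {t : ℂ}

theorem norm_mul_zpow_lt_one (ht : ‖t‖ < 1) {z : ℂ} (hz : ‖z‖ = 1) (m : ℤ) :
    ‖t * z ^ m‖ < 1 := by
  rwa [norm_mul, norm_zpow, hz, one_zpow, mul_one]

theorem one_sub_ne_zero_of_norm_lt_one {x : ℂ} (hx : ‖x‖ < 1) : 1 - x ≠ 0 := by
  intro h
  rw [← sub_eq_zero.mp h, norm_one] at hx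
  exact lt_irrefl _ hx

theorem circleIntegrable_contourIntegrand (d : ℕ) (ht : ‖t‖ < 1) :
    CircleIntegrable (contourIntegrand d t) 0 1 := by
  refine ContinuousOn.circleIntegrable zero_le_one ?_
  have h0 (z : ℂ) (hz : z ∈ Metric.sphere (0 : ℂ) 1) : ‖z‖ = 1 := by simpa using hz
  have hz0 (z : ℂ) (hz : z ∈ Metric.sphere (0 : ℂ) 1) : z ≠ 0 := by
    rw [← norm_ne_zero_iff, h0 z hz]; exact one_ne_zero
  unfold contourIntegrand
  refine ContinuousOn.mul (ContinuousOn.div (by fun_prop) ?_ ?_) ?_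
  · refine continuousOn_finsetProd _ fun k _ => ?_
    refine continuousOn_const.sub (continuousOn_const.mul ?_)
    exact continuousOn_id.zpow₀ _ fun z hz => Or.inl (hz0 z hz)
  · intro z hz
    exact Finset.prod_ne_zero_iff.mpr fun k _ =>
      one_sub_ne_zero_of_norm_lt_one (norm_mul_zpow_lt_one ht (h0 z hz) _)
  · exact continuousOn_const.div continuousOn_id hz0

/-- The contribution of a monomial to the expansion of the integrand. -/
noncomputable def contourTerm (d : ℕ) (t : ℂ) (l : Fin (d + 1) →₀ ℕ) (z : ℂ) : ℂ :=
  t ^ l.degree * (z ^ (-monomialWeight d l - 1) + z ^ (-monomialWeight d l))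

theorem contourTerm_eq {z : ℂ} (hz : z ≠ 0) (l : Fin (d + 1) →₀ ℕ) :
    contourTerm d t l z =
      (1 + z) * (1 / z) * ∏ i : Fin (d + 1), (t * z ^ (-weight d i)) ^ l i := by
  have h : ∏ i : Fin (d + 1), (t * z ^ (-weight d i)) ^ l i =
      t ^ l.degree * z ^ (-monomialWeight d l) := by
    simp only [mul_pow, Finset.prod_mul_distrib]
    rw [Finset.prod_pow_eq_pow_sum, Finsupp.degree_eq_sum, monomialWeight, ← Finset.sum_neg_distrib]
    congr 1
    rw [zpow_sum₀ hz]
    refine Finset.prod_congr rfl fun i _ => ?_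
    rw [← neg_mul, zpow_mul, zpow_natCast]
  rw [h, contourTerm, zpow_sub_one₀ hz]
  field_simp

theorem hasSum_contourTerm (ht : ‖t‖ < 1) {z : ℂ} (hz : ‖z‖ = 1) :
    HasSum (fun l => contourTerm d t l z) (contourIntegrand d t z) := by
  have hz0 : z ≠ 0 := by rw [← norm_ne_zero_iff, hz]; exact one_ne_zero
  have h := (hasSum_prod_pow (y := fun i : Fin (d + 1) => t * z ^ (-weight d i))
    fun i => norm_mul_zpow_lt_one ht hz _).mul_left ((1 + z) * (1 / z))
  have hp : ∏ k ∈ Finset.range (d + 1), (1 - t * z ^ ((d : ℤ) - 2 * (k : ℤ))) =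
      ∏ i : Fin (d + 1), (1 - t * z ^ (-weight d i)) := by
    -- Replacing `k` by `d - k` negates the exponents. The terms then carry `z` to minus the weight,
    -- so that weight `1` is counted and the symmetry between weights `1` and `-1` is not needed.
    rw [← Finset.prod_range_reflect, Finset.prod_range]
    refine Finset.prod_congr rfl fun i _ => ?_
    congr 3
    simp only [weight]
    have : (i : ℕ) ≤ d := by omega
    omega
  have hc : contourIntegrand d t z =
      (1 + z) * (1 / z) * (∏ i : Fin (d + 1), (1 - t * z ^ (-weight d i)))⁻¹ := by
    rw [← hp, contourIntegrand]
    ring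
  rw [hc]
  simpa only [contourTerm_eq hz0] using h

theorem norm_contourTerm_le {z : ℂ} (hz : ‖z‖ = 1) (l : Fin (d + 1) →₀ ℕ) :
    ‖contourTerm d t l z‖ ≤ 2 * ‖∏ i, (fun _ : Fin (d + 1) => t) i ^ l i‖ := by
  rw [contourTerm, norm_mul, Finset.prod_pow_eq_pow_sum, ← Finsupp.degree_eq_sum, mul_comm]
  refine mul_le_mul_of_nonneg_right ((norm_add_le _ _).trans ?_) (norm_nonneg _)
  rw [norm_zpow, norm_zpow, hz, one_zpow, one_zpow]
  norm_num

theorem circleIntegral_zpow (m : ℤ) :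
    (∮ z in C(0, 1), z ^ m : ℂ) = if m = -1 then 2 * Real.pi * Complex.I else 0 := by
  split_ifs with h
  · have := circleIntegral.integral_sub_center_inv 0 (one_ne_zero (α := ℝ))
    simpa [h] using this
  · simpa using circleIntegral.integral_sub_zpow_of_ne h 0 0 1

theorem circleIntegrable_zpow (m : ℤ) : CircleIntegrable (fun z : ℂ => z ^ m) 0 1 := by
  have := (circleIntegrable_sub_zpow_iff (c := 0) (w := 0) (R := 1) (n := m)).mpr (by simp)
  simpa using this

/-- Only the exponent `-1` contributes: the summand `1` of `1 + z` yields it at weight `0`, the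
summand `z` at weight `1`. -/
theorem circleIntegral_contourTerm (l : Fin (d + 1) →₀ ℕ) :
    (∮ z in C(0, 1), contourTerm d t l z) = 2 * Real.pi * Complex.I *
      (t ^ l.degree * ((if monomialWeight d l = 0 then 1 else 0) +
        (if monomialWeight d l = 1 then 1 else 0))) := by
  unfold contourTerm
  rw [circleIntegral.integral_const_mul, circleIntegral.integral_add (circleIntegrable_zpow _)
    (circleIntegrable_zpow _), circleIntegral_zpow, circleIntegral_zpow]
  have h0 : -monomialWeight d l - 1 = -1 ↔ monomialWeight d l = 0 := by omega
  have h1 : -monomialWeight d l = -1 ↔ monomialWeight d l = 1 := by omega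
  simp only [h0, h1]
  split_ifs <;> ring

/-- Dominated convergence: on the unit circle the terms are bounded by `2 * ‖t‖ ^ l.degree`, which
is summable over `l` and independent of the angle. -/
theorem hasSum_circleIntegral_contourTerm (d : ℕ) (ht : ‖t‖ < 1) :
    HasSum (fun l => ∮ z in C(0, 1), contourTerm d t l z)
      (∮ z in C(0, 1), contourIntegrand d t z) := by
  have hn (θ : ℝ) : ‖circleMap 0 1 θ‖ = 1 := by simp
  refine intervalIntegral.hasSum_integral_of_dominated_convergence
    (fun l _ => 2 * ‖∏ i, (fun _ : Fin (d + 1) => t) i ^ l i‖) ?_ ?_ ?_ ?_ ?_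
  · intro l
    refine Continuous.aestronglyMeasurable ?_
    have hz : Continuous (circleMap 0 1) := continuous_circleMap 0 1
    have h0 (m : ℤ) : Continuous fun θ => circleMap 0 1 θ ^ m :=
      hz.zpow₀ m fun θ => Or.inl (norm_ne_zero_iff.mp (by rw [hn]; exact one_ne_zero))
    simp only [deriv_circleMap, contourTerm]
    exact (hz.mul continuous_const).smul (continuous_const.mul ((h0 _).add (h0 _)))
  · intro l
    refine Filter.Eventually.of_forall fun θ _ => ?_
    rw [norm_smul, deriv_circleMap, norm_mul, hn, Complex.norm_I, one_mul, one_mul]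
    exact norm_contourTerm_le (hn θ) l
  · exact Filter.Eventually.of_forall fun θ _ => (summable_norm_prod_pow fun _ => ht).mul_left 2
  · exact intervalIntegrable_const
  · exact Filter.Eventually.of_forall fun θ _ =>
      (hasSum_contourTerm ht (hn θ)).const_smul (deriv (circleMap 0 1) θ)

theorem hasSum_weightMultiplicity (d : ℕ) (ht : ‖t‖ < 1) :
    HasSum (fun n : ℕ => ((weightMultiplicity d n 0 : ℂ) + weightMultiplicity d n 1) * t ^ n)
      ((2 * (Real.pi : ℂ) * Complex.I)⁻¹ * ∮ z in C(0, 1), contourIntegrand d t z) := by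
  have h := (hasSum_circleIntegral_contourTerm d ht).mul_left
    (2 * (Real.pi : ℂ) * Complex.I)⁻¹
  simp_rw [circleIntegral_contourTerm, inv_mul_cancel_left₀ Complex.two_pi_I_ne_zero] at h
  -- The sum over all exponent vectors is regrouped by degree; each fiber is the finite set
  -- `exponents d n`.
  rw [← (Equiv.sigmaFiberEquiv fun l : Fin (d + 1) →₀ ℕ => l.degree).hasSum_iff] at h
  refine h.sigma fun n => ?_
  rw [← (Equiv.subtypeEquivRight fun l : Fin (d + 1) →₀ ℕ =>
    mem_exponents (d := d) (n := n) (l := l)).hasSum_iff]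
  have hs : ((weightMultiplicity d n 0 : ℂ) + weightMultiplicity d n 1) * t ^ n =
      ∑ l ∈ exponents d n, t ^ l.degree * ((if monomialWeight d l = 0 then 1 else 0) +
        (if monomialWeight d l = 1 then 1 else 0)) := by
    rw [Finset.sum_congr rfl fun l hl => by rw [mem_exponents.mp hl], ← Finset.mul_sum,
      Finset.sum_add_distrib, Finset.sum_boole, Finset.sum_boole, mul_comm]
    rfl
  rw [hs]
  exact Finset.hasSum (exponents d n) fun l => t ^ l.degree *
    ((if monomialWeight d l = 0 then 1 else 0) + (if monomialWeight d l = 1 then 1 else 0))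

end Contour

end BinaryForms

theorem lemma3 (d : ℕ) :
    (∀ n : ℕ, Module.Finite ℂ (BinaryForms.covariantsOfDegree d n)) ∧
    PowerSeries.map (Int.castRingHom ℂ) (BinaryForms.poincareSeries d) =
      BinaryForms.Psi 1 d (BinaryForms.covariantGenFun d) ∧
    ∀ t : ℂ, ‖t‖ < 1 →
      CircleIntegrable (BinaryForms.contourIntegrand d t) 0 1 ∧
      HasSum
        (fun n : ℕ => ((PowerSeries.coeff n (BinaryForms.poincareSeries d) : ℤ) : ℂ) * t ^ n)
        ((2 * (Real.pi : ℂ) * Complex.I)⁻¹ *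
          ∮ z in C(0, 1), BinaryForms.contourIntegrand d t z) := by
  refine ⟨BinaryForms.finite_covariantsOfDegree d, ?_, fun t ht =>
    ⟨BinaryForms.circleIntegrable_contourIntegrand d ht, ?_⟩⟩
  · ext n
    rw [PowerSeries.coeff_map, BinaryForms.coeff_poincareSeries,
      BinaryForms.coeff_Psi_covariantGenFun]
    simp
  · simpa [BinaryForms.coeff_poincareSeries] using BinaryForms.hasSum_weightMultiplicity d ht
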